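/- **Theorem 4.1.** Let $d\in\{1,2\}$, let $\mathcal O\subset\mathbb R^d$ be bounded and open, $H=L^2(\mathcal O)$ with norm $\|\cdot\|$, and let $\Delta$ be the Dirichlet Laplacian on $\mathcal O$. *Drift.* Let $f$ be a real polynomial of odd degree $P$ with negative leading coefficient such that, for some $\theta,\alpha,K,L>0$ and all $u,v\in L^{2P}(\mathcal O)$, $$\langle f(u),u\rangle\le-\theta\|u\|^{\alpha}+K\|u\|^2,\qquad \langle f(u)-f(v),u-v\rangle\le L\|u-v\|^2 .$$ *Noise.* Let $U$ be a real Hilbert space whose elements are regarded as functions on $\mathcal O$ through a bounded linear map $U\to H$ (for instance $U=H$), let $Q$ be a symmetric non-negative trace class operator on $U$ with an orthonormal basis $(e_j)_{j\ge1}$ of eigenvectors, $Qe_j=q_je_j$, and let $W(t)=\sum_j\sqrt{q_j}\,\beta_j(t)e_j$, where the $\beta_j$ are independent standard Brownian motions with respect to a filtration $(\mathcal F_t)$ on a probability space. Let $g:\mathbb R\to\mathbb R$ and write $g(u)h$ for the pointwise product of $g(u(\cdot))$ with $h\in U$. Assume that for some $c\ge0$ and all $u,v\in H$ $$\|g(u)\|_{L_2^0}^2:=\sum_j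 q_j\|g(u)e_j\|^2\le c^2\|u\|^2,\qquad \|g(u)-g(v)\|\le c\|u-v\| .$$ *Schemes.* Let $u_0$ be an $\mathcal F_0$-measurable $H$-valued random variable with $\mathbf E\|u_0\|^2<\infty$ and $u_0\in L^{2P}(\mathcal O)$ almost surely. Let $\tau>0$, $M\in\mathbb N$, $T=M\tau$, $t_k=k\tau$, $\Delta W_k=W(t_{k+1})-W(t_k)$. The time scheme is $u^0=u_0$ and, for $0\le k\le M-1$, $$u^{k+1}-u^k=\tau\Delta u^{k+1}+\frac{\tau f(u^k)}{1+\tau\|f(u^k)\|^2}+g(u^k)\,\Delta W_k,$$ where $u^{k+1}\in H^1_0(\mathcal O)$, $\Delta u^{k+1}\in L^2(\mathcal O)$, and $f(u^k),\,g(u^k)\Delta W_k\in L^2(\mathcal O)$. For $N\in\mathbb N$ let $V_N$ be the space of polynomials of degree at most $N$ in each variable that vanish on $\partial\mathcal O$ (restricted to $\mathcal O$). The fully discrete scheme is $u_N^0=P_Nu_0$ ($L^2$-orthogonal projection onto $V_N$) and, for $0\le k\le M-1$, $u_N^{k+1}\in V_N$ with $$(u_N^{k+1}-u_N^k,\psi)=-\tau(\nabla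 u_N^{k+1},\nabla\psi)+\frac{\tau(f(u_N^k),\psi)}{1+\tau\|f(u_N^k)\|^2}+(g(u_N^k)\Delta W_k,\psi)\qquad\forall\psi\in V_N,$$ where $f(u_N^k),\,g(u_N^k)\Delta W_k\in L^2(\mathcal O)$. *Conclusion.* Both schemes have a solution which is adapted (the $k$-th iterate is $\mathcal F_{t_k}$-measurable), and it is unique at every step up to almost sure equality. Without any restriction on $\tau$, for all $0\le k\le M-1$ and all $N$, $$\mathbf E\|u^{k+1}\|^2+2\tau\sum_{j=0}^k\mathbf E\|\nabla u^{j+1}\|^2\le e^{(2K+2\kappa)T}\,\mathbf E\|u^0\|^2+\frac{e^{(2K+2\kappa)T}}{K+\kappa},$$ $$\mathbf E\|u_N^{k+1}\|^2+2\tau\sum_{j=0}^k\mathbf E\|\nabla u_N^{j+1}\|^2\le e^{(2K+2\kappa)T}\,\mathbf E\|u_N^0\|^2+\frac{e^{(2K+2\kappa)T}}{K+\kappa},$$ both with $\kappa=c_1^2\,\mathrm{Tr}(Q)$, for every $c_1\ge0$ such that $\|g(u)e_j\|\le c_1\|u\|$ for all $u\in H$ and all $j$ with $q_j>0$ (in particular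 if $\|g(u)\|_{\mathcal L(U,H)}\le c_1\|u\|$ for all $u\in H$), and with $\kappa=c^2$. -/

import Mathlib

open MeasureTheory ProbabilityTheory Set Filter Topology
open scoped NNReal ENNReal

namespace TamedSPDE

noncomputable section

/-- Euclidean space of dimension `d`. -/
abbrev E (d : ℕ) : Type := EuclideanSpace ℝ (Fin d)

/-- Lebesgue measure on the domain `O`. -/
abbrev mu {d : ℕ} (O : Set (E d)) : Measure (E d) := volume.restrict O

/-- The Hilbert space `H = L²(O)`. -/
abbrev L2 {d : ℕ} (O : Set (E d)) : Type := Lp ℝ 2 (mu O)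

/-- Square integrable vector fields on `O`. -/
abbrev L2V {d : ℕ} (O : Set (E d)) : Type := Lp (E d) 2 (mu O)

/-! ### Spaces and gradients

A space of functions with gradient is given by its graph: the set of the pairs `(u, ∇u)` in
`L²(O) × L²(O; ℝᵈ)`. -/

/-- The pairs `(φ, ∇φ)` with `φ ∈ C_c^∞(O)`. -/
def testGraph {d : ℕ} (O : Set (E d)) : Set (L2 O × L2V O) :=
  {p | ∃ φ : E d → ℝ, ContDiff ℝ (⊤ : ℕ∞) φ ∧ HasCompactSupport φ ∧ tsupport φ ⊆ O ∧
    p.1 =ᵐ[mu O] φ ∧ p.2 =ᵐ[mu O] gradient φ}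

/-- `H¹₀(O)`, the closure of `C_c^∞(O)` in the `H¹` norm: the pairs `(u, ∇u)` with `u ∈ H¹₀(O)`. -/
def h10Graph {d : ℕ} (O : Set (E d)) : Set (L2 O × L2V O) :=
  closure (testGraph O)

/-- The polynomial space `V_N`: the pairs `(u, ∇u)` where `u` is (the restriction to `O` of) a
polynomial of degree at most `N` in each variable that vanishes on the boundary of `O`. -/
def polyGraph {d : ℕ} (O : Set (E d)) (N : ℕ) : Set (L2 O × L2V O) :=
  {p | ∃ a ∈ MvPolynomial.restrictDegree (Fin d) ℝ N,
    (∀ x ∈ frontier O, MvPolynomial.eval (fun i => x i) a = 0) ∧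
    p.1 =ᵐ[mu O] (fun x => MvPolynomial.eval (fun i => x i) a) ∧
    p.2 =ᵐ[mu O] gradient (fun x : E d => MvPolynomial.eval (fun i => x i) a)}

/-- `‖∇u‖²` for `u` in the space with graph `S`, and `∞` for `u` outside that space. -/
def gradSq {d : ℕ} {O : Set (E d)} (S : Set (L2 O × L2V O)) (u : L2 O) : ℝ≥0∞ :=
  ⨅ (G : L2V O) (_ : (u, G) ∈ S), ‖G‖ₑ ^ 2

/-- `u` is in the domain of the Dirichlet Laplacian and `Δu = w`: `u ∈ H¹₀(O)` and `w ∈ L²(O)` is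
the Laplacian of `u` in the sense of distributions. -/
def HasLaplacian {d : ℕ} {O : Set (E d)} (u w : L2 O) : Prop :=
  ∃ G : L2V O, (u, G) ∈ h10Graph O ∧ ∀ p ∈ testGraph O, inner ℝ G p.2 = - inner ℝ w p.1

/-! ### The drift -/

/-- The `L²(O)` norm of a square integrable function. -/
def nrm {d : ℕ} (O : Set (E d)) (u : E d → ℝ) : ℝ := (eLpNorm u 2 (mu O)).toReal

/-- `f` is a polynomial of odd degree `P` with negative leading coefficient, whose Nemytskii
operator is coercive and one-sided Lipschitz on `L^{2P}(O)`. -/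
structure DriftAssumption {d : ℕ} (O : Set (E d)) (f : Polynomial ℝ) (θ α K L : ℝ) : Prop where
  odd : Odd f.natDegree
  lead : f.leadingCoeff < 0
  theta_pos : 0 < θ
  alpha_pos : 0 < α
  K_pos : 0 < K
  L_pos : 0 < L
  coercive : ∀ u : E d → ℝ, MemLp u ((2 * f.natDegree : ℕ) : ℝ≥0∞) (mu O) →
    ∫ x, f.eval (u x) * u x ∂(mu O) ≤ -θ * nrm O u ^ α + K * nrm O u ^ 2
  one_sided : ∀ u v : E d → ℝ, MemLp u ((2 * f.natDegree : ℕ) : ℝ≥0∞) (mu O) →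
    MemLp v ((2 * f.natDegree : ℕ) : ℝ≥0∞) (mu O) →
    ∫ x, (f.eval (u x) - f.eval (v x)) * (u x - v x) ∂(mu O) ≤ L * nrm O (u - v) ^ 2

/-! ### The noise

`U` is the Hilbert space of the noise, `ι : U → L²(O)` turns its elements into functions on `O`
(`U = L²(O)` and `ι = id` is the basic case). -/

section Noise

variable {U : Type*} [NormedAddCommGroup U] [InnerProductSpace ℝ U]

/-- `Q` is a symmetric non-negative trace class operator with eigenpairs `(q j, e j)`, where `e` is
an orthonormal basis of `U`. -/
structure IsCovariance (Q : U →L[ℝ] U) (e : HilbertBasis ℕ ℝ U) (q : ℕ → ℝ) : Prop where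
  eigen : ∀ j, Q (e j) = q j • e j
  nonneg : ∀ j, 0 ≤ q j
  traceClass : Summable q

/-- The trace `∑ⱼ (Q eⱼ, eⱼ)`. -/
def trace (Q : U →L[ℝ] U) (e : HilbertBasis ℕ ℝ U) : ℝ := ∑' j, inner ℝ (Q (e j)) (e j)

/-- The `L²(O)` norm of `g(u) h`, the image of `h ∈ U` under the multiplication operator `g(u)`;
it is `∞` if this function is not square integrable. -/
def mulNorm {d : ℕ} {O : Set (E d)} (ι : U →L[ℝ] L2 O) (g : ℝ → ℝ) (u : L2 O) (h : U) : ℝ≥0∞ :=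
  eLpNorm (fun x => g (u x) * ι h x) 2 (mu O)

/-- The squared norm `‖g(u)‖²` in `L₂⁰`, that is `‖g(u) Q^{1/2}‖²_{HS} = ∑ⱼ qⱼ ‖g(u) eⱼ‖²`. -/
def hsNormSq {d : ℕ} {O : Set (E d)} (ι : U →L[ℝ] L2 O) (e : HilbertBasis ℕ ℝ U) (q : ℕ → ℝ)
    (g : ℝ → ℝ) (u : L2 O) : ℝ≥0∞ :=
  ∑' j, ENNReal.ofReal (q j) * mulNorm ι g u (e j) ^ 2

/-- Linear growth `‖g(u)‖_{L₂⁰} ≤ c ‖u‖` and Lipschitz continuity `‖g(u) - g(v)‖ ≤ c ‖u - v‖`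
on `L²(O)`. -/
structure DiffusionAssumption {d : ℕ} {O : Set (E d)} (ι : U →L[ℝ] L2 O) (e : HilbertBasis ℕ ℝ U)
    (q : ℕ → ℝ) (g : ℝ → ℝ) (c : ℝ≥0) : Prop where
  growth : ∀ u : L2 O, hsNormSq ι e q g u ≤ (c * ‖u‖ₑ) ^ 2
  lipschitz : ∀ u v : L2 O, eLpNorm (fun x => g (u x) - g (v x)) 2 (mu O) ≤ c * ‖u - v‖ₑ

/-- Linear growth of the operator `g(u) : U → L²(O)` on the unit vectors `eⱼ`:
`‖g(u) eⱼ‖ ≤ c ‖u‖` for all modes that are present in the noise. -/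
def ModeGrowth {d : ℕ} {O : Set (E d)} (ι : U →L[ℝ] L2 O) (e : HilbertBasis ℕ ℝ U)
    (q : ℕ → ℝ) (g : ℝ → ℝ) (c : ℝ≥0) : Prop :=
  ∀ j, 0 < q j → ∀ u : L2 O, mulNorm ι g u (e j) ≤ c * ‖u‖ₑ

variable {Ω : Type*} {mΩ : MeasurableSpace Ω}

/-- `β` is a sequence of independent standard real Brownian motions with respect to `𝓕`. -/
structure IsBrownianFamily (P : Measure Ω) (𝓕 : Filtration ℝ≥0 mΩ) (β : ℕ → ℝ≥0 → Ω → ℝ) :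
    Prop where
  brownian : ∀ j, IsBrownianReal (β j) P
  indep : iIndepFun (fun j ω t => β j t ω) P
  adapted : ∀ j t, Measurable[𝓕 t] (β j t)
  indep_past : ∀ s t : ℝ≥0, s ≤ t →
    Indep (⨆ j, MeasurableSpace.comap (fun ω => β j t ω - β j s ω) inferInstance) (𝓕 s) P

/-- The `Q`-Wiener process `W(t) = ∑ⱼ √qⱼ βⱼ(t) eⱼ`; the series converges in `U` almost surely. -/
def wiener (e : HilbertBasis ℕ ℝ U) (q : ℕ → ℝ) (β : ℕ → ℝ≥0 → Ω → ℝ) (t : ℝ≥0) (ω : Ω) : U :=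
  ∑' j, (Real.sqrt (q j) * β j t ω) • e j

/-- The increment `W(t_{k+1}) - W(t_k)`, `t_k = k τ`, as a function on `O`. -/
def increment {d : ℕ} {O : Set (E d)} (ι : U →L[ℝ] L2 O) (e : HilbertBasis ℕ ℝ U) (q : ℕ → ℝ)
    (β : ℕ → ℝ≥0 → Ω → ℝ) (τ : ℝ≥0) (k : ℕ) (ω : Ω) : L2 O :=
  ι (wiener e q β ((k + 1 : ℕ) * τ) ω - wiener e q β (k * τ) ω)

end Noise

/-! ### The schemes -/

/-- The denominator `1 + τ ‖f(u)‖²`. -/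
def taming {d : ℕ} {O : Set (E d)} (f : Polynomial ℝ) (τ : ℝ≥0) (u : L2 O) : ℝ :=
  1 + τ * ∫ x, f.eval (u x) ^ 2 ∂(mu O)

/-- The two explicit terms of a step, `f(u)` and `g(u) ΔW`, are in `L²(O)`. -/
def Admissible {d : ℕ} {O : Set (E d)} (f : Polynomial ℝ) (g : ℝ → ℝ) (u dW : L2 O) : Prop :=
  MemLp (fun x => f.eval (u x)) 2 (mu O) ∧ MemLp (fun x => g (u x) * dW x) 2 (mu O)

/-- One step `u ↦ v` of the tamed semi-implicit time scheme with noise increment `dW`: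
`v - u = τ Δv + τ f(u) / (1 + τ ‖f(u)‖²) + g(u) dW`, as an equation in `L²(O)`. -/
def TimeStep {d : ℕ} {O : Set (E d)} (f : Polynomial ℝ) (g : ℝ → ℝ) (τ : ℝ≥0)
    (u dW v : L2 O) : Prop :=
  Admissible f g u dW ∧ ∃ w : L2 O, HasLaplacian v w ∧
    ∀ᵐ x ∂(mu O), v x - u x =
      τ * w x + τ * f.eval (u x) / taming f τ u + g (u x) * dW x

/-- One step `u ↦ v` of the fully discrete scheme: `v ∈ V_N` and for all `ψ ∈ V_N`
`(v - u, ψ) = - τ (∇v, ∇ψ) + τ (f(u), ψ) / (1 + τ ‖f(u)‖²) + (g(u) dW, ψ)`. -/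
def FullStep {d : ℕ} {O : Set (E d)} (N : ℕ) (f : Polynomial ℝ) (g : ℝ → ℝ) (τ : ℝ≥0)
    (u dW v : L2 O) : Prop :=
  Admissible f g u dW ∧ ∃ G : L2V O, (v, G) ∈ polyGraph O N ∧
    ∀ p ∈ polyGraph O N, inner ℝ (v - u) p.1 =
      - τ * inner ℝ G p.2 + τ * (∫ x, f.eval (u x) * p.1 x ∂(mu O)) / taming f τ u
        + ∫ x, g (u x) * dW x * p.1 x ∂(mu O)

/-- `v = P_N u`, the `L²(O)`-orthogonal projection of `u` onto `V_N`. -/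
def IsProjection {d : ℕ} {O : Set (E d)} (N : ℕ) (u v : L2 O) : Prop :=
  (∃ G : L2V O, (v, G) ∈ polyGraph O N) ∧ ∀ p ∈ polyGraph O N, inner ℝ v p.1 = inner ℝ u p.1

variable {Ω : Type*} {mΩ : MeasurableSpace Ω}

/-- `u 0, …, u M` is a solution of the time scheme with noise increments `dW k` and initial
value `u₀`. -/
structure IsTimeSolution {d : ℕ} {O : Set (E d)} (P : Measure Ω) (f : Polynomial ℝ) (g : ℝ → ℝ)
    (τ : ℝ≥0) (M : ℕ) (dW : ℕ → Ω → L2 O) (u₀ : Ω → L2 O) (u : ℕ → Ω → L2 O) : Prop where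
  init : u 0 =ᵐ[P] u₀
  step : ∀ k < M, ∀ᵐ ω ∂P, TimeStep f g τ (u k ω) (dW k ω) (u (k + 1) ω)

/-- `u 0, …, u M` is a solution of the fully discrete scheme with noise increments `dW k` and
initial value `P_N u₀`. -/
structure IsFullSolution {d : ℕ} {O : Set (E d)} (P : Measure Ω) (N : ℕ) (f : Polynomial ℝ)
    (g : ℝ → ℝ) (τ : ℝ≥0) (M : ℕ) (dW : ℕ → Ω → L2 O) (u₀ : Ω → L2 O) (u : ℕ → Ω → L2 O) :
    Prop where
  init : ∀ᵐ ω ∂P, IsProjection N (u₀ ω) (u 0 ω)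
  step : ∀ k < M, ∀ᵐ ω ∂P, FullStep N f g τ (u k ω) (dW k ω) (u (k + 1) ω)

/-- Existence of an adapted solution, and almost sure uniqueness at every step. -/
def UniquelySolvable {d : ℕ} {O : Set (E d)} (P : Measure Ω) (𝓕 : Filtration ℝ≥0 mΩ) (τ : ℝ≥0)
    (M : ℕ) (IsSol : (ℕ → Ω → L2 O) → Prop) : Prop :=
  (∃ u, IsSol u ∧ ∀ k ≤ M, StronglyMeasurable[𝓕 (k * τ)] (u k)) ∧
  ∀ u v, IsSol u → IsSol v → ∀ k ≤ M, u k =ᵐ[P] v k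

/-- For all `k < M`, with `T = M τ` and `R = exp ((2 K + 2 κ) T)`,
`𝐄‖u^{k+1}‖² + 2 τ ∑_{j ≤ k} 𝐄‖∇u^{j+1}‖² ≤ R 𝐄‖u^0‖² + R / (K + κ)`. -/
def Stable {d : ℕ} {O : Set (E d)} (P : Measure Ω) (S : Set (L2 O × L2V O)) (τ : ℝ≥0) (M : ℕ)
    (K κ : ℝ) (u : ℕ → Ω → L2 O) : Prop :=
  ∀ k < M,
    ∫⁻ ω, ‖u (k + 1) ω‖ₑ ^ 2 ∂P
        + 2 * τ * ∑ j ∈ Finset.range (k + 1), ∫⁻ ω, gradSq S (u (j + 1) ω) ∂P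
      ≤ ENNReal.ofReal (Real.exp ((2 * K + 2 * κ) * (M * τ))) * ∫⁻ ω, ‖u 0 ω‖ₑ ^ 2 ∂P
        + ENNReal.ofReal (Real.exp ((2 * K + 2 * κ) * (M * τ)) / (K + κ))

end

end TamedSPDE

open TamedSPDE

/-! Both schemes are one problem on a closed subspace `S` of pairs (function, gradient), the graph
of `H¹₀` or of `V_N`: find `(v, G) ∈ S` with `⟪v, p⟫ + τ ⟪G, p'⟫ = ⟪b, p⟫` for all `(p, p') ∈ S`,
where `b = X + Z`, `X = u + τ f(u) / (1 + τ ‖f(u)‖²)` and `Z = g(u) ΔW`. The solution is a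
continuous linear function of `b` (`exists_variational_resolvent`), so adaptedness is inherited from
`b`, and uniqueness is pathwise.

Stability: testing with `v` itself gives `‖v‖² + 2τ‖G‖² ≤ ‖b‖²`. As `Z` is orthogonal in mean to
everything known at time `t_k`, `𝐄‖b‖² = 𝐄‖X‖² + 𝐄‖Z‖²`. The taming bounds `‖X‖²` by `(1 + 2τK)‖u‖²
+ τ` for every `τ` (`norm_tamed_sq_le`), and the Itô isometry gives `𝐄‖Z‖² = τ 𝐄‖g(u)‖²_{L₂⁰} ≤ τκ
𝐄‖u‖²` (`exists_noise_term`). A discrete Gronwall argument for the energy plus the accumulated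
gradient terms finishes.

The remaining work is to make sense of `b`. For `f(u) ∈ L²` the iterates must stay in `L^{2P}`: this
is the Sobolev embedding of `H¹₀` when `d ≤ 2`, and boundedness of polynomials for `V_N`. For `g(u)
ΔW`, the series `∑ⱼ √qⱼ Δβⱼ g(u) eⱼ` is orthogonal in `L²(Ω; L²(O))`, and its sum is then identified
pathwise with the product. Since `u ↦ f(u)` and `u ↦ g(u) eⱼ` need not map all of `L²` into `L²`,
measurability comes from truncation (`exists_measurable_superposition`). -/

namespace TamedSPDE

/-! ### The implicit step as a variational problem -/

/-- The solution operator of `⟪v, p⟫ + τ ⟪G, p'⟫ = ⟪h, p⟫` for all `(p, p') ∈ S`, `(v, G) ∈ S`. -/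
theorem exists_variational_resolvent {H V : Type*} [NormedAddCommGroup H] [InnerProductSpace ℝ H]
    [CompleteSpace H] [NormedAddCommGroup V] [InnerProductSpace ℝ V] [CompleteSpace V]
    (S : Submodule ℝ (H × V)) (hS : IsClosed (S : Set (H × V))) {τ : ℝ} (hτ : 0 < τ) :
    ∃ R : H →L[ℝ] H × V, ∀ h, R h ∈ S ∧
      ∀ p ∈ S, inner ℝ (R h).1 p.1 + τ * inner ℝ (R h).2 p.2 = inner ℝ h p.1 := by
  -- In the variable `x = (v, √τ G)` the form `⟪v, p⟫ + τ ⟪G, p'⟫` is the standard inner product of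
  -- the Hilbert sum. Hence the solution is the orthogonal projection of `(h, 0)` onto the rescaled
  -- subspace `K`, and `T` undoes the scaling.
  let T : WithLp 2 (H × V) →L[ℝ] H × V :=
    ((ContinuousLinearMap.id ℝ H).prodMap ((Real.sqrt τ)⁻¹ • ContinuousLinearMap.id ℝ V)).comp
      (WithLp.prodContinuousLinearEquiv 2 ℝ H V).toContinuousLinearMap
  have hT (x : WithLp 2 (H × V)) : T x = (x.fst, (Real.sqrt τ)⁻¹ • x.snd) := rfl
  let K : Submodule ℝ (WithLp 2 (H × V)) := S.comap T.toLinearMap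
  have hK : IsClosed (K : Set (WithLp 2 (H × V))) := hS.preimage T.continuous
  have : CompleteSpace K := hK.completeSpace_coe
  let J : H →L[ℝ] WithLp 2 (H × V) :=
    (WithLp.prodContinuousLinearEquiv 2 ℝ H V).symm.toContinuousLinearMap.comp
      (ContinuousLinearMap.inl ℝ H V)
  have hJ (h : H) : J h = WithLp.toLp 2 (h, 0) := rfl
  have hs : Real.sqrt τ ≠ 0 := (Real.sqrt_pos.2 hτ).ne'
  have hss : Real.sqrt τ * Real.sqrt τ = τ := Real.mul_self_sqrt hτ.le
  refine ⟨T.comp (K.starProjection.comp J), fun h => ⟨?_, fun p hp => ?_⟩⟩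
  · exact K.starProjection_apply_mem (J h)
  · have hmem : WithLp.toLp 2 (p.1, Real.sqrt τ • p.2) ∈ K := by
      change T _ ∈ S
      rw [hT]
      simpa [smul_smul, inv_mul_cancel₀ hs] using hp
    have h0 := K.starProjection_inner_eq_zero (J h) _ hmem
    rw [hJ, WithLp.prod_inner_apply] at h0
    simp only [ContinuousLinearMap.comp_apply, hT, hJ]
    set x := K.starProjection (WithLp.toLp 2 (h, 0))
    simp only [WithLp.ofLp_sub, Prod.fst_sub, Prod.snd_sub, zero_sub, inner_sub_left,
      inner_neg_left, inner_smul_right] at h0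
    rw [real_inner_smul_left]
    change inner ℝ h p.1 - inner ℝ x.fst p.1 + √τ * -inner ℝ x.snd p.2 = 0 at h0
    have h1 : τ * ((√τ)⁻¹ * inner ℝ x.snd p.2) = √τ * inner ℝ x.snd p.2 := by
      rw [← mul_assoc, ← hss]
      congr 1
      rw [Real.sqrt_mul_self (Real.sqrt_nonneg τ)]
      field_simp
    rw [h1]; linarith

/-- Solutions of the variational equation are unique. -/
theorem variational_unique {H V : Type*} [NormedAddCommGroup H] [InnerProductSpace ℝ H]
    [NormedAddCommGroup V] [InnerProductSpace ℝ V]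
    (S : Submodule ℝ (H × V)) {τ : ℝ} (hτ : 0 < τ) {F : H × V → ℝ} {v v' : H} {G G' : V}
    (hv : (v, G) ∈ S) (hv' : (v', G') ∈ S)
    (h : ∀ p ∈ S, inner ℝ v p.1 + τ * inner ℝ G p.2 = F p)
    (h' : ∀ p ∈ S, inner ℝ v' p.1 + τ * inner ℝ G' p.2 = F p) : v = v' := by
  have hd := S.sub_mem hv hv'
  have h1 := h _ hd
  rw [← h' _ hd] at h1
  simp only [Prod.mk_sub_mk] at h1
  have h2 : inner ℝ (v - v') (v - v') + τ * inner ℝ (G - G') (G - G') = 0 := by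
    rw [inner_sub_left (𝕜 := ℝ) v v', inner_sub_left (𝕜 := ℝ) G G']; linarith
  rw [real_inner_self_eq_norm_sq, real_inner_self_eq_norm_sq] at h2
  have h3 : ‖v - v'‖ ^ 2 = 0 := by nlinarith [sq_nonneg ‖v - v'‖, mul_nonneg hτ.le (sq_nonneg ‖G - G'‖)]
  simpa [sub_eq_zero] using h3

/-! ### Orthogonal series and stochastic increments -/

theorem Orthogonal.tendsto_sum_range {E : Type*} [NormedAddCommGroup E] [InnerProductSpace ℝ E]
    [CompleteSpace E] (z : ℕ → E) (hz : ∀ i j, i ≠ j → inner ℝ (z i) (z j) = 0)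
    (hs : Summable fun i => ‖z i‖ ^ 2) :
    ∃ Z : E, Tendsto (fun n => ∑ j ∈ Finset.range n, z j) atTop (𝓝 Z) ∧
      ‖Z‖ ^ 2 = ∑' i, ‖z i‖ ^ 2 := by
  -- The `z i` are not normalised and may vanish, so the orthogonal family consists of the spans of
  -- the single vectors.
  let G : ℕ → Submodule ℝ E := fun i => Submodule.span ℝ {z i}
  have hV : OrthogonalFamily ℝ (fun i => G i) (fun i => (G i).subtypeₗᵢ) := by
    intro i j hij v w
    obtain ⟨a, ha⟩ := Submodule.mem_span_singleton.1 v.2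
    obtain ⟨b, hb⟩ := Submodule.mem_span_singleton.1 w.2
    simp only [Submodule.coe_subtypeₗᵢ, Submodule.coe_subtype]
    rw [← ha, ← hb, inner_smul_left, inner_smul_right, hz i j hij]
    simp
  let f : ∀ i, G i := fun i => ⟨z i, Submodule.mem_span_singleton_self _⟩
  have h1 : Summable fun i => z i := (hV.summable_iff_norm_sq_summable f).2 hs
  refine ⟨_, h1.hasSum.tendsto_sum_nat, ?_⟩
  refine tendsto_nhds_unique ((h1.hasSum.tendsto_sum_nat.norm).pow 2) ?_
  convert hs.hasSum.tendsto_sum_nat using 2 with n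
  exact hV.norm_sum f (Finset.range n)

section

variable {Ω : Type*} {mΩ : MeasurableSpace Ω} {P : Measure Ω}

theorem integral_mul_of_indep {m A : MeasurableSpace Ω} (hm : m ≤ mΩ) (hA : A ≤ mΩ)
    (h : Indep A m P) {ρ ψ : Ω → ℝ} (hρ : Measurable[A] ρ) (hψ : Measurable[m] ψ) :
    ∫ ω, ρ ω * ψ ω ∂P = (∫ ω, ρ ω ∂P) * ∫ ω, ψ ω ∂P := by
  have hi : IndepFun ρ ψ P :=
    indep_of_indep_of_le_left (indep_of_indep_of_le_right h hψ.comap_le) hρ.comap_le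
  exact hi.integral_fun_mul_eq_mul_integral (hρ.mono hA le_rfl).aestronglyMeasurable
    (hψ.mono hm le_rfl).aestronglyMeasurable

variable {H : Type*} [NormedAddCommGroup H]

theorem stronglyMeasurable_limUnder [CompleteSpace H] {m : MeasurableSpace Ω} {f : ℕ → Ω → H}
    (hf : ∀ n, StronglyMeasurable[m] (f n)) :
    StronglyMeasurable[m] fun ω => limUnder atTop fun n => f n ω :=
  StronglyMeasurable.limUnder (l := atTop) hf

theorem lintegral_enorm_sq_eq_ofReal {X : Ω → H} (hX : MemLp X 2 P) :
    ∫⁻ ω, ‖X ω‖ₑ ^ 2 ∂P = ENNReal.ofReal (∫ ω, ‖X ω‖ ^ 2 ∂P) := by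
  rw [ofReal_integral_eq_lintegral_ofReal hX.norm.integrable_sq
    (Eventually.of_forall fun ω => sq_nonneg _)]
  refine lintegral_congr fun ω => ?_
  rw [ENNReal.ofReal_pow (norm_nonneg _), ofReal_norm]

theorem memLp_two_of_lintegral_lt_top {X : Ω → H} (hX : AEStronglyMeasurable X P)
    (h : ∫⁻ ω, ‖X ω‖ₑ ^ 2 ∂P < ∞) : MemLp X 2 P := by
  refine ⟨hX, ?_⟩
  rw [eLpNorm_lt_top_iff_lintegral_rpow_enorm_lt_top (by norm_num) (by norm_num)]
  simpa using h

theorem coeFn_sum_range {p : ℝ≥0∞} (z : ℕ → Lp H p P) (n : ℕ) :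
    ∀ᵐ ω ∂P, (∑ j ∈ Finset.range n, z j : Lp H p P) ω = ∑ j ∈ Finset.range n, z j ω := by
  induction n with
  | zero => filter_upwards [Lp.coeFn_zero H p P] with ω h; simpa using h
  | succ n ih =>
    simp only [Finset.sum_range_succ]
    filter_upwards [ih, Lp.coeFn_add (∑ j ∈ Finset.range n, z j) (z n)] with ω h1 h2
    rw [h2, Pi.add_apply, h1]

variable [InnerProductSpace ℝ H] [CompleteSpace H]

/-- The stochastic increment `∑ⱼ ξⱼ Yⱼ`, for real `ξⱼ` that are centred, uncorrelated and
independent of the past `m`, and for `H`-valued `Yⱼ` that are `m`-measurable. -/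
theorem exists_stochastic_increment [IsProbabilityMeasure P] {m m' : MeasurableSpace Ω}
    (hm : m ≤ m') (hm' : m' ≤ mΩ) {ξ : ℕ → Ω → ℝ} (hξ : ∀ j, Measurable[m'] (ξ j))
    (hξ0 : ∀ j, ∫ ω, ξ j ω ∂P = 0) {σ : ℝ≥0}
    (hξσ : ∀ j, ∫⁻ ω, ‖ξ j ω‖ₑ ^ 2 ∂P = σ)
    (hξξ : ∀ i j, i ≠ j → ∫ ω, ξ i ω * ξ j ω ∂P = 0)
    (hind : Indep (⨆ j, MeasurableSpace.comap (ξ j) inferInstance) m P)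
    {Y : ℕ → Ω → H} (hY : ∀ j, StronglyMeasurable[m] (Y j))
    (hYs : ∑' j, ∫⁻ ω, ‖Y j ω‖ₑ ^ 2 ∂P ≠ ∞) :
    ∃ Z : Ω → H, StronglyMeasurable[m'] Z ∧
      (∃ ns : ℕ → ℕ, StrictMono ns ∧ ∀ᵐ ω ∂P,
        Tendsto (fun i => ∑ j ∈ Finset.range (ns i), ξ j ω • Y j ω) atTop (𝓝 (Z ω))) ∧
      MemLp Z 2 P ∧ ∫⁻ ω, ‖Z ω‖ₑ ^ 2 ∂P = σ * ∑' j, ∫⁻ ω, ‖Y j ω‖ₑ ^ 2 ∂P ∧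
      ∀ X : Ω → H, StronglyMeasurable[m] X → MemLp X 2 P → ∫ ω, inner ℝ (X ω) (Z ω) ∂P = 0 := by
  set A : MeasurableSpace Ω := ⨆ j, MeasurableSpace.comap (ξ j) inferInstance
  have hA : A ≤ mΩ := iSup_le fun j => ((hξ j).mono hm' le_rfl).comap_le
  have hmΩ : m ≤ mΩ := hm.trans hm'
  have hξA (j) : Measurable[A] (ξ j) :=
    Measurable.of_comap_le (le_iSup (fun j => MeasurableSpace.comap (ξ j) inferInstance) j)
  have hzm (j) : StronglyMeasurable[m'] fun ω => ξ j ω • Y j ω :=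
    (hξ j).stronglyMeasurable.smul ((hY j).mono hm)
  have hz2 (j) : ∫⁻ ω, ‖ξ j ω • Y j ω‖ₑ ^ 2 ∂P = σ * ∫⁻ ω, ‖Y j ω‖ₑ ^ 2 ∂P := by
    simp_rw [enorm_smul, mul_pow]
    rw [lintegral_mul_eq_lintegral_mul_lintegral_of_independent_measurableSpace hA hmΩ hind
      (f := fun ω => ‖ξ j ω‖ₑ ^ 2) (g := fun ω => ‖Y j ω‖ₑ ^ 2) ((hξA j).enorm.pow_const 2)
      ((hY j).enorm.pow_const 2), hξσ]
  have hYf (j) : ∫⁻ ω, ‖Y j ω‖ₑ ^ 2 ∂P < ∞ := (ENNReal.ne_top_of_tsum_ne_top hYs j).lt_top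
  have hzL (j) : MemLp (fun ω => ξ j ω • Y j ω) 2 P := by
    refine memLp_two_of_lintegral_lt_top ((hzm j).mono hm').aestronglyMeasurable ?_
    rw [hz2]; exact ENNReal.mul_lt_top ENNReal.coe_lt_top (hYf j)
  let z : ℕ → Lp H 2 P := fun j => (hzL j).toLp _
  have hinner (X : Ω → H) (hX : MemLp X 2 P) (j : ℕ) :
      inner ℝ (hX.toLp X) (z j) = ∫ ω, ξ j ω * inner ℝ (X ω) (Y j ω) ∂P := by
    rw [L2.inner_def]
    refine integral_congr_ae ?_
    filter_upwards [hX.coeFn_toLp, (hzL j).coeFn_toLp] with ω h1 h2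
    rw [h1, h2, inner_smul_right]
  -- `ξᵢ ξⱼ` is independent of the `m`-measurable factor `⟪Yᵢ, Yⱼ⟫` and has mean zero, so the terms
  -- are orthogonal in `L²(Ω; H)`.
  have horth (i j) (hij : i ≠ j) : inner ℝ (z i) (z j) = 0 := by
    rw [hinner _ (hzL i) j]
    have := integral_mul_of_indep hmΩ hA hind (ρ := fun ω => ξ i ω * ξ j ω)
      (ψ := fun ω => inner ℝ (Y i ω) (Y j ω)) ((hξA i).mul (hξA j))
      ((hY i).inner (hY j)).measurable
    rw [hξξ i j hij, zero_mul] at this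
    rw [← this]
    refine integral_congr_ae (Eventually.of_forall fun ω => ?_)
    simp only [inner_smul_left, conj_trivial]; ring
  have hnz (j) : ENNReal.ofReal (‖z j‖ ^ 2) = σ * ∫⁻ ω, ‖Y j ω‖ₑ ^ 2 ∂P := by
    rw [← hz2, ENNReal.ofReal_pow (norm_nonneg _), ofReal_norm, Lp.enorm_toLp,
      eLpNorm_eq_lintegral_rpow_enorm_toReal (by norm_num) (by norm_num), ← ENNReal.rpow_natCast,
      ← ENNReal.rpow_mul]
    simp
  have hsum : Summable fun j => ‖z j‖ ^ 2 := by
    have : ∑' j, ENNReal.ofReal (‖z j‖ ^ 2) ≠ ∞ := by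
      simp_rw [hnz]; rw [ENNReal.tsum_mul_left]; exact ENNReal.mul_ne_top ENNReal.coe_ne_top hYs
    simpa using ENNReal.summable_toReal this
  obtain ⟨Z₀, hZ₀, hZ₀n⟩ := Orthogonal.tendsto_sum_range z horth hsum
  obtain ⟨ns, hns, hae⟩ := (tendstoInMeasure_of_tendsto_Lp hZ₀).exists_seq_tendsto_ae
  have hlim : ∀ᵐ ω ∂P, Tendsto (fun i => ∑ j ∈ Finset.range (ns i), ξ j ω • Y j ω) atTop
      (𝓝 (Z₀ ω)) := by
    have h2 : ∀ᵐ ω ∂P, ∀ j, z j ω = ξ j ω • Y j ω := ae_all_iff.2 fun j => (hzL j).coeFn_toLp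
    have h3 : ∀ᵐ ω ∂P, ∀ n, (∑ j ∈ Finset.range n, z j : Lp H 2 P) ω =
        ∑ j ∈ Finset.range n, z j ω := ae_all_iff.2 fun n => coeFn_sum_range z n
    filter_upwards [hae, h2, h3] with ω h1 h2 h3
    simpa only [h3, h2] using h1
  -- A pointwise limit of `m'`-measurable sums is itself `m'`-measurable; a representative of the
  -- `L²` limit `Z₀` would be so only up to null sets.
  let Z : Ω → H := fun ω => limUnder atTop fun i => ∑ j ∈ Finset.range (ns i), ξ j ω • Y j ω
  have hZae : Z =ᵐ[P] Z₀ := by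
    filter_upwards [hlim] with ω h using h.limUnder_eq
  have hZL : MemLp Z 2 P := (memLp_congr_ae hZae).2 (Lp.memLp Z₀)
  refine ⟨Z, stronglyMeasurable_limUnder fun i => ?_, ⟨ns, hns, ?_⟩, hZL, ?_, ?_⟩
  · exact Finset.stronglyMeasurable_fun_sum _ fun j _ => hzm j
  · filter_upwards [hlim, hZae] with ω h1 h2
    rwa [h2]
  · have h1 : ∫⁻ ω, ‖Z ω‖ₑ ^ 2 ∂P = ENNReal.ofReal (‖Z₀‖ ^ 2) := by
      rw [ENNReal.ofReal_pow (norm_nonneg _), ofReal_norm, Lp.enorm_def,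
        eLpNorm_eq_lintegral_rpow_enorm_toReal (by norm_num) (by norm_num), ← ENNReal.rpow_natCast,
        ← ENNReal.rpow_mul]
      simp only [ENNReal.toReal_ofNat, Nat.cast_ofNat, ne_eq, OfNat.ofNat_ne_zero,
        not_false_eq_true, div_mul_cancel₀, ENNReal.rpow_one, ENNReal.rpow_ofNat]
      refine lintegral_congr_ae ?_
      filter_upwards [hZae] with ω h
      rw [h]
    rw [h1, hZ₀n, ENNReal.ofReal_tsum_of_nonneg (fun _ => sq_nonneg _) hsum]
    simp_rw [hnz]
    rw [ENNReal.tsum_mul_left]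
  · intro X hXm hX
    have h1 : ∫ ω, inner ℝ (X ω) (Z ω) ∂P = inner ℝ (hX.toLp X) Z₀ := by
      rw [L2.inner_def]
      refine integral_congr_ae ?_
      filter_upwards [hX.coeFn_toLp, hZae] with ω h1 h2
      rw [h1, h2]
    rw [h1]
    have h2 : Tendsto (fun n => inner ℝ (hX.toLp X) (∑ j ∈ Finset.range n, z j)) atTop
        (𝓝 (inner ℝ (hX.toLp X) Z₀)) := tendsto_const_nhds.inner hZ₀
    refine tendsto_nhds_unique h2 ?_
    have h3 : ∀ j, inner ℝ (hX.toLp X) (z j) = 0 := fun j => by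
      rw [hinner X hX j, integral_mul_of_indep hmΩ hA hind (hξA j) (hXm.inner (hY j)).measurable,
        hξ0, zero_mul]
    simp [inner_sum, h3]

end

/-! ### Superposition operators on `L²` -/

section

variable {X : Type*} [MeasurableSpace X] {μ : Measure X}

theorem tendsto_Lp_two_of_dominated {f : ℕ → Lp ℝ 2 μ} {f₀ : Lp ℝ 2 μ} {b : X → ℝ}
    (hb : MemLp b 2 μ) (hbd : ∀ n, ∀ᵐ x ∂μ, ‖f n x‖ ≤ b x)
    (hlim : ∀ᵐ x ∂μ, Tendsto (fun n => f n x) atTop (𝓝 (f₀ x))) : Tendsto f atTop (𝓝 f₀) := by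
  rw [Lp.tendsto_Lp_iff_tendsto_eLpNorm']
  have hbd' := ae_all_iff.2 hbd
  have key : Tendsto (fun n => ∫⁻ x, ‖(f n - f₀ : X → ℝ) x‖ₑ ^ 2 ∂μ) atTop
      (𝓝 (∫⁻ _, 0 ∂μ)) := by
    refine tendsto_lintegral_of_dominated_convergence' (fun x => ‖2 * b x‖ₑ ^ 2) ?_ ?_ ?_ ?_
    · intro n
      exact (((Lp.aestronglyMeasurable _).sub (Lp.aestronglyMeasurable _)).enorm).pow_const 2
    · intro n
      filter_upwards [hbd', hlim] with x h1 h2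
      have h3 : ‖f₀ x‖ ≤ b x := le_of_tendsto h2.norm (Eventually.of_forall h1)
      have h4 : ‖(f n - f₀ : X → ℝ) x‖ ≤ ‖2 * b x‖ := by
        refine (norm_sub_le _ _).trans ?_
        rw [Real.norm_eq_abs (2 * b x)]
        exact le_trans (by linarith [h1 n]) (le_abs_self _)
      gcongr
      exact enorm_le_iff_norm_le.2 h4
    · have := (hb.const_mul 2).2
      rw [eLpNorm_lt_top_iff_lintegral_rpow_enorm_lt_top (by norm_num) (by norm_num)] at this
      simpa using this.ne
    · filter_upwards [hlim] with x h
      have h5 : Tendsto (fun n => ‖f n x - f₀ x‖ₑ ^ 2) atTop (𝓝 (‖f₀ x - f₀ x‖ₑ ^ 2)) :=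
        (ENNReal.continuous_pow 2).tendsto _ |>.comp ((h.sub_const _).enorm)
      simpa using h5
  rw [lintegral_zero] at key
  have h6 := (ENNReal.continuous_rpow_const (y := 1 / 2)).tendsto (0 : ℝ≥0∞) |>.comp key
  rw [ENNReal.zero_rpow_of_pos (by norm_num)] at h6
  convert h6 using 2 with n
  rw [eLpNorm_eq_lintegral_rpow_enorm_toReal (by norm_num) (by norm_num)]
  simp

/-- Truncation makes `u ↦ clip n (φ(u)) h` defined and continuous on the whole of `L²`, which `u ↦
φ(u) h` need not be. -/
noncomputable def clip (n : ℕ) (y : ℝ) : ℝ := max (-n) (min n y)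

theorem continuous_clip (n : ℕ) : Continuous (clip n) := by unfold clip; fun_prop

theorem abs_clip_le (n : ℕ) (y : ℝ) : |clip n y| ≤ n := by
  have : (0 : ℝ) ≤ n := n.cast_nonneg
  rw [abs_le]
  exact ⟨le_max_left _ _, max_le (by linarith) (min_le_left _ _)⟩

theorem abs_clip_le_abs (n : ℕ) (y : ℝ) : |clip n y| ≤ |y| := by
  have : (0 : ℝ) ≤ n := n.cast_nonneg
  rw [abs_le, clip]
  refine ⟨?_, max_le (by linarith [abs_nonneg y]) ((min_le_right _ _).trans (le_abs_self y))⟩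
  rcases le_total (n : ℝ) y with h | h
  · rw [min_eq_left h]; exact le_max_of_le_right (by linarith [abs_nonneg y])
  · rw [min_eq_right h]; exact le_max_of_le_right (neg_abs_le y)

theorem tendsto_clip (y : ℝ) : Tendsto (fun n => clip n y) atTop (𝓝 y) := by
  refine tendsto_const_nhds.congr' ?_
  filter_upwards [eventually_ge_atTop ⌈|y|⌉₊] with n hn
  have : |y| ≤ n := (Nat.le_ceil _).trans (by exact_mod_cast hn)
  rw [abs_le] at this
  rw [clip, min_eq_right this.2, max_eq_right this.1]

theorem memLp_clip_mul {φ : ℝ → ℝ} (hφ : Continuous φ) (h : Lp ℝ 2 μ) (n : ℕ) (u : Lp ℝ 2 μ) :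
    MemLp (fun x => clip n (φ (u x)) * h x) 2 μ := by
  refine ((Lp.memLp h).const_mul (n : ℝ)).mono ?_ (Eventually.of_forall fun x => ?_)
  · exact (((continuous_clip n).comp hφ).comp_aestronglyMeasurable
      (Lp.aestronglyMeasurable u)).mul (Lp.aestronglyMeasurable h)
  · rw [norm_mul, norm_mul, Real.norm_eq_abs (n : ℝ), Nat.abs_cast]
    exact mul_le_mul_of_nonneg_right (abs_clip_le n _) (norm_nonneg _)

theorem continuous_clip_mul {φ : ℝ → ℝ} (hφ : Continuous φ) (h : Lp ℝ 2 μ) (n : ℕ) :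
    Continuous fun u : Lp ℝ 2 μ => (memLp_clip_mul hφ h n u).toLp _ := by
  refine continuous_iff_seqContinuous.2 fun v u hv => ?_
  -- Convergence in `L²` gives convergence almost everywhere only along subsequences, which is
  -- enough by the subsequence criterion; dominated convergence then applies with the bound `n |h|`.
  refine tendsto_of_subseq_tendsto fun ns hns => ?_
  obtain ⟨ms, hms, hae⟩ := (tendstoInMeasure_of_tendsto_Lp (hv.comp hns)).exists_seq_tendsto_ae
  refine ⟨ms, tendsto_Lp_two_of_dominated ((Lp.memLp h).norm.const_mul (n : ℝ)) ?_ ?_⟩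
  · intro i
    filter_upwards [(memLp_clip_mul hφ h n (v (ns (ms i)))).coeFn_toLp] with x hx
    simp only [Function.comp_apply]
    rw [hx, norm_mul]
    exact mul_le_mul_of_nonneg_right (abs_clip_le n _) (norm_nonneg _)
  · have h1 := ae_all_iff.2 fun i => (memLp_clip_mul hφ h n (v (ns (ms i)))).coeFn_toLp
    filter_upwards [h1, hae, (memLp_clip_mul hφ h n u).coeFn_toLp] with x h1 h2 h3
    simp only [Function.comp_apply, h1, h3]
    exact ((((continuous_clip n).comp hφ).tendsto _).comp h2).mul_const _

/-- The superposition operator `u ↦ φ(u) h` is a measurable operator in `L²`. -/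
theorem exists_measurable_superposition {φ : ℝ → ℝ} (hφ : Continuous φ) (h : Lp ℝ 2 μ) :
    ∃ T : Lp ℝ 2 μ → Lp ℝ 2 μ,
      (∀ {Ω : Type*} (m : MeasurableSpace Ω) (Y : Ω → Lp ℝ 2 μ), StronglyMeasurable[m] Y →
        StronglyMeasurable[m] fun ω => T (Y ω)) ∧
      ∀ (u : Lp ℝ 2 μ) (hu : MemLp (fun x => φ (u x) * h x) 2 μ), T u = hu.toLp _ := by
  -- This operator is total: where `φ(u) h` is not in `L²` and no limit exists, `limUnder` takes a
  -- default value, without harm to measurability.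
  refine ⟨fun u => limUnder atTop fun n => (memLp_clip_mul hφ h n u).toLp _, ?_, ?_⟩
  · intro Ω m Y hY
    exact stronglyMeasurable_limUnder fun n => (continuous_clip_mul hφ h n).comp_stronglyMeasurable hY
  · intro u hu
    refine Tendsto.limUnder_eq (tendsto_Lp_two_of_dominated hu.norm ?_ ?_)
    · intro n
      filter_upwards [(memLp_clip_mul hφ h n u).coeFn_toLp] with x hx
      rw [hx, norm_mul, norm_mul]
      exact mul_le_mul_of_nonneg_right (abs_clip_le_abs n _) (norm_nonneg _)
    · have h1 := ae_all_iff.2 fun n => (memLp_clip_mul hφ h n u).coeFn_toLp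
      filter_upwards [h1, hu.coeFn_toLp] with x h1 h2
      simp only [h1, h2]
      exact (tendsto_clip _).mul_const _

/-- A function whose superposition operator is Lipschitz on `L²` is continuous, up to the case of
the zero measure. -/
theorem exists_continuous_superposition [IsFiniteMeasure μ] {g : ℝ → ℝ} {c : ℝ≥0}
    (hg : ∀ u v : Lp ℝ 2 μ, eLpNorm (fun x => g (u x) - g (v x)) 2 μ ≤ c * ‖u - v‖ₑ) :
    ∃ g' : ℝ → ℝ, Continuous g' ∧ ∀ u : X → ℝ, ∀ᵐ x ∂μ, g (u x) = g' (u x) := by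
  rcases eq_or_ne μ 0 with h0 | h0
  · exact ⟨0, continuous_const, fun u => by simp [h0]⟩
  refine ⟨g, ?_, fun u => Eventually.of_forall fun x => rfl⟩
  -- Constants belong to `L²` of a finite measure; on them the hypothesis is the scalar Lipschitz
  -- bound times a power of the total mass, which is finite and nonzero.
  have : LipschitzWith c g := by
    intro a b
    have h1 := hg ((memLp_const a).toLp _) ((memLp_const b).toLp _)
    rw [← MemLp.toLp_sub, Lp.enorm_toLp] at h1
    have h2 : eLpNorm (fun x => g ((memLp_const (μ := μ) (p := 2) a).toLp _ x) -
        g ((memLp_const (μ := μ) (p := 2) b).toLp _ x)) 2 μ = eLpNorm (fun _ => g a - g b) 2 μ := by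
      refine eLpNorm_congr_ae ?_
      filter_upwards [(memLp_const (μ := μ) (p := 2) a).coeFn_toLp,
        (memLp_const (μ := μ) (p := 2) b).coeFn_toLp] with x ha hb
      rw [ha, hb]
    have h3 : (fun _ : X => a) - (fun _ => b) = fun _ => a - b := rfl
    rw [h2, h3, eLpNorm_const _ (by norm_num) h0, eLpNorm_const _ (by norm_num) h0,
      ← mul_assoc] at h1
    rw [edist_eq_enorm_sub, edist_eq_enorm_sub]
    refine (ENNReal.mul_le_mul_iff_left ?_ ?_).1 h1
    · have : μ univ ≠ 0 := by simpa using h0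
      simp [this]
    · exact ENNReal.rpow_ne_top_of_nonneg (by simp) (measure_ne_top _ _)
  exact this.continuous

theorem memLp_pow_two {u : X → ℝ} (i : ℕ) (hi : i ≠ 0)
    (hu : MemLp u ((2 * i : ℕ) : ℝ≥0∞) μ) : MemLp (fun x => u x ^ i) 2 μ := by
  have h := hu.norm_rpow_div (i : ℝ≥0∞)
  have h1 : ((2 * i : ℕ) : ℝ≥0∞) / (i : ℝ≥0∞) = 2 := by
    push_cast
    rw [mul_div_assoc, ENNReal.div_self (by exact_mod_cast hi) (by simp), mul_one]
  rw [h1] at h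
  refine (memLp_congr_norm (hu.1.pow i) h.1 ?_).2 h
  refine Eventually.of_forall fun x => ?_
  simp

/-- The origin of the exponent `2P`: `u ^ i` is square integrable when `u ∈ L^{2i}`, and on a finite
measure space `L^{2P} ⊆ L^{2i}` for `i ≤ P`. -/
theorem memLp_polynomial_eval [IsFiniteMeasure μ] (f : Polynomial ℝ) {u : X → ℝ}
    (hu : MemLp u ((2 * f.natDegree : ℕ) : ℝ≥0∞) μ) : MemLp (fun x => f.eval (u x)) 2 μ := by
  simp_rw [Polynomial.eval_eq_sum_range]
  refine memLp_finsetSum _ fun i hi => ?_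
  refine MemLp.const_mul ?_ _
  rcases Nat.eq_zero_or_pos i with rfl | hi0
  · simpa using memLp_const (1 : ℝ)
  · refine memLp_pow_two i hi0.ne' (hu.mono_exponent ?_)
    have : i ≤ f.natDegree := by simpa [Nat.lt_succ_iff] using hi
    exact_mod_cast Nat.mul_le_mul_left 2 this

end

/-! ### The embedding of `H¹₀` into `L^q` in dimensions one and two -/

section Sobolev

theorem isFiniteMeasure_mu {d : ℕ} {O : Set (E d)} (hOb : Bornology.IsBounded O) :
    IsFiniteMeasure (mu O) :=
  ⟨by rw [Measure.restrict_apply_univ]; exact hOb.measure_lt_top⟩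

theorem eLpNorm_fderiv_restrict {d : ℕ} {O : Set (E d)} {φ : E d → ℝ} (h : tsupport φ ⊆ O)
    (p : ℝ≥0∞) : eLpNorm (fderiv ℝ φ) p (mu O) = eLpNorm (fderiv ℝ φ) p volume := by
  refine eLpNorm_restrict_eq_of_support_subset (f := fderiv ℝ φ) ?_
  exact (support_fderiv_subset ℝ).trans h

/-- The fundamental theorem of calculus on a half-line, transported through the isometry between `ℝ`
and `E 1`. -/
theorem enorm_le_lintegral_fderiv {φ : E 1 → ℝ} (hφ : ContDiff ℝ 1 φ) (hc : HasCompactSupport φ)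
    (x : E 1) : ‖φ x‖ₑ ≤ ∫⁻ y, ‖fderiv ℝ φ y‖ₑ := by
  let A : ℝ ≃ₗᵢ[ℝ] E 1 := (OrthonormalBasis.singleton (Fin 1) ℝ).repr
  have h1 : ContDiff ℝ 1 (φ ∘ A) := hφ.comp A.contDiff
  have h2 : HasCompactSupport (φ ∘ A) := hc.comp_homeomorph A.toHomeomorph
  have h3 := HasCompactSupport.enorm_le_lintegral_Ici_deriv h1 h2 (A.symm x)
  simp only [Function.comp_apply, LinearIsometryEquiv.apply_symm_apply] at h3
  refine h3.trans ((setLIntegral_le_lintegral _ _).trans ?_)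
  rw [← (LinearIsometryEquiv.measurePreserving A).lintegral_comp_emb
    A.toMeasurableEquiv.measurableEmbedding]
  refine lintegral_mono fun t => ?_
  have h4 : deriv (φ ∘ A) t = fderiv ℝ φ (A t) (A 1) := by
    rw [← fderiv_apply_one_eq_deriv, fderiv_comp _ (hφ.differentiable one_ne_zero _)
      A.differentiableAt, ContinuousLinearMap.comp_apply, LinearIsometryEquiv.fderiv]
    rfl
  rw [h4, enorm_le_iff_norm_le]
  refine (ContinuousLinearMap.le_opNorm _ _).trans ?_
  simp

/-- The Sobolev inequality `‖φ‖_{L^q} ≤ C ‖∇φ‖_{L²}` on a bounded set in dimension one and two. -/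
theorem exists_sobolev_const {d : ℕ} (hd : d = 1 ∨ d = 2) {O : Set (E d)}
    (hOb : Bornology.IsBounded O) (q : ℕ) (hq : 2 ≤ q) :
    ∃ C : ℝ≥0∞, C ≠ ∞ ∧ ∀ φ : E d → ℝ, ContDiff ℝ 1 φ → HasCompactSupport φ → tsupport φ ⊆ O →
      eLpNorm φ q (mu O) ≤ C * eLpNorm (fderiv ℝ φ) 2 (mu O) := by
  have := isFiniteMeasure_mu hOb
  have hfin (r : ℝ) (hr : 0 ≤ r) : mu O univ ^ r ≠ ∞ :=
    ENNReal.rpow_ne_top_of_nonneg hr (measure_ne_top _ _)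
  have hq0 : (0 : ℝ) < q := by exact_mod_cast (by omega : 0 < q)
  rcases hd with rfl | rfl
  · refine ⟨mu O univ ^ (1 / (q : ℝ)) * mu O univ ^ ((1 : ℝ) - 1 / 2),
      ENNReal.mul_ne_top (hfin _ (by positivity)) (hfin _ (by norm_num)), fun φ h1 h2 h3 => ?_⟩
    have h4 : eLpNorm φ q (mu O) ≤ eLpNorm (fderiv ℝ φ) 1 (mu O) * mu O univ ^ (1 / (q : ℝ)) := by
      have h5 := eLpNorm_mono_enorm (μ := mu O) (p := q) (f := φ)
        (g := fun _ => (∫⁻ y, ‖fderiv ℝ φ y‖ₑ)) fun x => by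
          simpa using enorm_le_lintegral_fderiv h1 h2 x
      refine h5.trans (le_of_eq ?_)
      rw [eLpNorm_const' _ (by exact_mod_cast (by omega : q ≠ 0)) (by simp),
        eLpNorm_fderiv_restrict h3, eLpNorm_one_eq_lintegral_enorm]
      simp
    have h6 := eLpNorm_le_eLpNorm_mul_rpow_measure_univ (μ := mu O) (p := 1) (q := 2)
      (by norm_num) (h1.continuous_fderiv one_ne_zero).aestronglyMeasurable
    simp only [ENNReal.toReal_one, ENNReal.toReal_ofNat, div_one] at h6
    refine h4.trans ?_
    grw [h6]
    exact le_of_eq (by ring)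
  -- The exponent with Sobolev conjugate `2p / (2 - p) = q`; `q ≥ 2` gives `p ≥ 1`, and `p < 2`
  -- always. Hölder's inequality then passes from the `L^p` to the `L²` norm of the gradient.
  · let p : ℝ≥0 := 2 * q / (q + 2)
    have hp1 : 1 ≤ p := by
      rw [one_le_div (by positivity)]
      have : (2 : ℝ≥0) ≤ q := by exact_mod_cast hq
      calc (q : ℝ≥0) + 2 ≤ q + q := by gcongr
        _ = 2 * q := by ring
    have hp2 : p < 2 := by
      rw [div_lt_iff₀ (by positivity)]
      calc (2 : ℝ≥0) * q < 2 * q + 4 := lt_add_of_pos_right _ (by norm_num)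
        _ = 2 * (q + 2) := by ring
    have hfr : Module.finrank ℝ (E 2) = 2 := by simp
    have hp0 : (0 : ℝ) < p := lt_of_lt_of_le one_pos (by exact_mod_cast hp1)
    have hr : (0 : ℝ) ≤ 1 / (p : ℝ) - 1 / 2 := by
      rw [sub_nonneg]
      exact one_div_le_one_div_of_le hp0 (by exact_mod_cast hp2.le)
    refine ⟨eLpNormLESNormFDerivOfLeConst ℝ (volume : Measure (E 2)) O p q *
      mu O univ ^ (1 / (p : ℝ) - 1 / 2),
      ENNReal.mul_ne_top ENNReal.coe_ne_top (hfin _ hr), fun φ h1 h2 h3 => ?_⟩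
    have h4 := eLpNorm_le_eLpNorm_fderiv_of_le (volume : Measure (E 2)) h1
      ((subset_tsupport φ).trans h3) (p := p) (q := q) hp1 (by rw [hfr]; exact_mod_cast hp2) ?_ hOb
    · rw [← eLpNorm_restrict_eq_of_support_subset ((subset_tsupport φ).trans h3),
        ← eLpNorm_fderiv_restrict h3] at h4
      have h6 := eLpNorm_le_eLpNorm_mul_rpow_measure_univ (μ := mu O) (p := p) (q := 2)
        (by exact_mod_cast hp2.le) (h1.continuous_fderiv one_ne_zero).aestronglyMeasurable
      simp only [ENNReal.toReal_ofNat, ENNReal.coe_toReal] at h6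
      rw [ENNReal.coe_natCast] at h4
      refine h4.trans ?_
      grw [h6]
      exact le_of_eq (by ring)
    · rw [hfr]
      simp only [p]
      push_cast
      rw [inv_div]
      apply le_of_eq
      field_simp
      ring

theorem enorm_fderiv_eq_enorm_gradient {d : ℕ} (φ : E d → ℝ) (x : E d) :
    ‖fderiv ℝ φ x‖ₑ = ‖gradient φ x‖ₑ := by
  rw [gradient, LinearIsometryEquiv.enorm_map]

/-- `H¹₀(O) ⊆ L^q(O)` in dimension one and two. -/
theorem memLp_of_mem_h10Graph {d : ℕ} (hd : d = 1 ∨ d = 2) {O : Set (E d)}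
    (hOb : Bornology.IsBounded O) (q : ℕ) (hq : 2 ≤ q) {p : L2 O × L2V O} (hp : p ∈ h10Graph O) :
    MemLp p.1 q (mu O) := by
  obtain ⟨C, hC, hS⟩ := exists_sobolev_const hd hOb q hq
  have htest : ∀ p ∈ testGraph O, eLpNorm p.1 q (mu O) ≤ C * ‖p.2‖ₑ := by
    rintro p ⟨φ, h1, h2, h3, h4, h5⟩
    rw [eLpNorm_congr_ae h4, Lp.enorm_def, eLpNorm_congr_ae h5]
    refine (hS φ (h1.of_le (by simp)) h2 h3).trans (le_of_eq ?_)
    rw [eLpNorm_congr_enorm_ae (Eventually.of_forall (enorm_fderiv_eq_enorm_gradient φ))]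
  obtain ⟨s, hs, hlim⟩ := mem_closure_iff_seq_limit.1 hp
  have hl1 : Tendsto (fun n => (s n).1) atTop (𝓝 p.1) := (continuous_fst.tendsto _).comp hlim
  have hl2 : Tendsto (fun n => (s n).2) atTop (𝓝 p.2) := (continuous_snd.tendsto _).comp hlim
  obtain ⟨ns, hns, hae⟩ := (tendstoInMeasure_of_tendsto_Lp hl1).exists_seq_tendsto_ae
  refine ⟨Lp.aestronglyMeasurable _, ?_⟩
  -- Fatou's lemma: the `L^q` norm is lower semicontinuous under convergence almost everywhere, and
  -- along the test functions it is controlled by the gradient norms, which converge.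
  have h := Lp.eLpNorm_lim_le_liminf_eLpNorm (p := (q : ℝ≥0∞))
    (fun n => Lp.aestronglyMeasurable ((s (ns n)).1)) _ hae
  refine h.trans_lt ?_
  have hb : Tendsto (fun n => C * ‖(s (ns n)).2‖ₑ) atTop (𝓝 (C * ‖p.2‖ₑ)) :=
    ENNReal.Tendsto.const_mul ((hl2.comp hns.tendsto_atTop).enorm) (Or.inr hC)
  calc liminf (fun n => eLpNorm ((s (ns n)).1) q (mu O)) atTop
      ≤ liminf (fun n => C * ‖(s (ns n)).2‖ₑ) atTop :=
        liminf_le_liminf (Eventually.of_forall fun n => htest _ (hs _))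
    _ = C * ‖p.2‖ₑ := hb.liminf_eq
    _ < ∞ := ENNReal.mul_lt_top hC.lt_top enorm_lt_top

end Sobolev

/-! ### The graphs of `H¹₀` and `V_N` as closed subspaces -/

section Graphs

variable {d : ℕ} {O : Set (E d)}

theorem gradient_add_apply {φ ψ : E d → ℝ} (hφ : Differentiable ℝ φ) (hψ : Differentiable ℝ ψ)
    (x : E d) : gradient (φ + ψ) x = gradient φ x + gradient ψ x := by
  simp only [gradient]
  rw [fderiv_add (hφ x) (hψ x), map_add]

theorem gradient_const_smul_apply {φ : E d → ℝ} (hφ : Differentiable ℝ φ) (c : ℝ)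
    (x : E d) : gradient (c • φ) x = c • gradient φ x := by
  simp only [gradient]
  rw [fderiv_const_smul (hφ x), map_smul]

variable (O) in
/-- `testGraph` as a linear subspace. -/
noncomputable def testSubmodule : Submodule ℝ (L2 O × L2V O) where
  carrier := testGraph O
  zero_mem' := by
    refine ⟨0, contDiff_const, HasCompactSupport.zero, by simp [tsupport], ?_, ?_⟩
    · exact Lp.coeFn_zero _ _ _
    · filter_upwards [Lp.coeFn_zero (E d) 2 (mu O)] with x hx
      simp only [Prod.snd_zero, hx, Pi.zero_apply, gradient]
      simp
  add_mem' := by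
    rintro p q ⟨φ, h1, h2, h3, h4, h5⟩ ⟨ψ, k1, k2, k3, k4, k5⟩
    refine ⟨φ + ψ, h1.add k1, h2.add k2,
      (tsupport_add φ ψ).trans (union_subset h3 k3), ?_, ?_⟩
    · filter_upwards [Lp.coeFn_add p.1 q.1, h4, k4] with x e1 e2 e3
      rw [Prod.fst_add, e1, Pi.add_apply, e2, e3, Pi.add_apply]
    · filter_upwards [Lp.coeFn_add p.2 q.2, h5, k5] with x e1 e2 e3
      rw [Prod.snd_add, e1, Pi.add_apply, e2, e3,
        gradient_add_apply (h1.differentiable (by simp)) (k1.differentiable (by simp))]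
  smul_mem' := by
    rintro c p ⟨φ, h1, h2, h3, h4, h5⟩
    refine ⟨c • φ, h1.const_smul c, h2.smul_left (f := fun _ => c),
      (closure_mono (Function.support_const_smul_subset c φ)).trans h3, ?_, ?_⟩
    · filter_upwards [Lp.coeFn_smul c p.1, h4] with x e1 e2
      rw [Prod.smul_fst, e1, Pi.smul_apply, e2, Pi.smul_apply]
    · filter_upwards [Lp.coeFn_smul c p.2, h5] with x e1 e2
      rw [Prod.smul_snd, e1, Pi.smul_apply, e2,
        gradient_const_smul_apply (h1.differentiable (by simp))]

variable (O) in
/-- `h10Graph` as a closed linear subspace. -/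
noncomputable def h10Submodule : Submodule ℝ (L2 O × L2V O) := (testSubmodule O).topologicalClosure

theorem coe_h10Submodule : (h10Submodule O : Set (L2 O × L2V O)) = h10Graph O :=
  Submodule.topologicalClosure_coe _

theorem isClosed_h10Submodule : IsClosed (h10Submodule O : Set (L2 O × L2V O)) :=
  Submodule.isClosed_topologicalClosure _

theorem contDiff_mvPolynomial_eval (a : MvPolynomial (Fin d) ℝ) :
    ContDiff ℝ 1 fun x : E d => MvPolynomial.eval (fun i => x i) a := by
  induction a using MvPolynomial.induction_on with
  | C r => simpa using contDiff_const
  | add p q hp hq => simpa using hp.add hq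
  | mul_X p i hp =>
    simp only [map_mul, MvPolynomial.eval_X]
    exact hp.mul (by fun_prop)

theorem memLp_of_continuous {F : Type*} [NormedAddCommGroup F] [SecondCountableTopology F]
    (hOb : Bornology.IsBounded O) {φ : E d → F} (hφ : Continuous φ) (p : ℝ≥0∞) (hO : MeasurableSet O) :
    MemLp φ p (mu O) := by
  have := isFiniteMeasure_mu hOb
  obtain ⟨C, hC⟩ := hOb.isCompact_closure.exists_bound_of_continuousOn hφ.continuousOn
  refine MemLp.of_bound hφ.aestronglyMeasurable C ?_
  filter_upwards [ae_restrict_mem hO] with x hx using hC x (subset_closure hx)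

theorem continuous_gradient {φ : E d → ℝ} (hφ : ContDiff ℝ 1 φ) : Continuous (gradient φ) :=
  (LinearIsometryEquiv.continuous _).comp (hφ.continuous_fderiv one_ne_zero)

variable (O) in
/-- The polynomials of degree at most `N` in each variable that vanish on the boundary of `O`. -/
def vanishingPolys (N : ℕ) : Submodule ℝ (MvPolynomial (Fin d) ℝ) where
  carrier := {a | a ∈ MvPolynomial.restrictDegree (Fin d) ℝ N ∧
    ∀ x ∈ frontier O, MvPolynomial.eval (fun i => x i) a = 0}
  zero_mem' := ⟨Submodule.zero_mem _, by simp⟩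
  add_mem' := by
    rintro a b ⟨h1, h2⟩ ⟨k1, k2⟩
    exact ⟨Submodule.add_mem _ h1 k1, fun x hx => by simp [h2 x hx, k2 x hx]⟩
  smul_mem' := by
    rintro c a ⟨h1, h2⟩
    exact ⟨Submodule.smul_mem _ c h1, fun x hx => by simp [MvPolynomial.smul_eval, h2 x hx]⟩

theorem finite_vanishingPolys (N : ℕ) : Module.Finite ℝ (vanishingPolys O N) :=
  Submodule.finiteDimensional_of_le (S₂ := MvPolynomial.restrictDegree (Fin d) ℝ N) fun _ h => h.1

/-- A polynomial and its gradient as elements of `L²`. -/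
noncomputable def polyMap (hO : IsOpen O) (hOb : Bornology.IsBounded O) :
    MvPolynomial (Fin d) ℝ →ₗ[ℝ] L2 O × L2V O where
  toFun a := ((memLp_of_continuous hOb (contDiff_mvPolynomial_eval a).continuous 2
      hO.measurableSet).toLp _,
    (memLp_of_continuous hOb (continuous_gradient (contDiff_mvPolynomial_eval a)) 2
      hO.measurableSet).toLp _)
  map_add' a b := by
    have h : (fun x : E d => MvPolynomial.eval (fun i => x i) (a + b)) =
      (fun x : E d => MvPolynomial.eval (fun i => x i) a) +
        fun x : E d => MvPolynomial.eval (fun i => x i) b := by ext x; simp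
    refine Prod.ext ?_ ?_
    · simp only [Prod.mk_add_mk, ← MemLp.toLp_add]
      congr 1
    · simp only [Prod.mk_add_mk, ← MemLp.toLp_add]
      congr 1
      ext1 x
      rw [h, gradient_add_apply ((contDiff_mvPolynomial_eval a).differentiable one_ne_zero)
        ((contDiff_mvPolynomial_eval b).differentiable one_ne_zero)]
      rfl
  map_smul' c a := by
    have h : (fun x : E d => MvPolynomial.eval (fun i => x i) (c • a)) =
      c • (fun x : E d => MvPolynomial.eval (fun i => x i) a) := by
        ext x; simp [MvPolynomial.smul_eval]
    refine Prod.ext ?_ ?_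
    · simp only [RingHom.id_apply, Prod.smul_mk, ← MemLp.toLp_const_smul]
      congr 1
    · simp only [RingHom.id_apply, Prod.smul_mk, ← MemLp.toLp_const_smul]
      congr 1
      ext1 x
      rw [h, gradient_const_smul_apply ((contDiff_mvPolynomial_eval a).differentiable one_ne_zero)]
      rfl

theorem coeFn_polyMap_fst (hO : IsOpen O) (hOb : Bornology.IsBounded O)
    (a : MvPolynomial (Fin d) ℝ) :
    (polyMap hO hOb a).1 =ᵐ[mu O] fun x => MvPolynomial.eval (fun i => x i) a :=
  (memLp_of_continuous hOb (contDiff_mvPolynomial_eval a).continuous 2 hO.measurableSet).coeFn_toLp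

theorem coeFn_polyMap_snd (hO : IsOpen O) (hOb : Bornology.IsBounded O)
    (a : MvPolynomial (Fin d) ℝ) :
    (polyMap hO hOb a).2 =ᵐ[mu O] gradient fun x : E d => MvPolynomial.eval (fun i => x i) a :=
  (memLp_of_continuous hOb (continuous_gradient (contDiff_mvPolynomial_eval a)) 2
    hO.measurableSet).coeFn_toLp

/-- `polyGraph` as a linear subspace. -/
noncomputable def polySubmodule (hO : IsOpen O) (hOb : Bornology.IsBounded O) (N : ℕ) :
    Submodule ℝ (L2 O × L2V O) :=
  (vanishingPolys O N).map (polyMap hO hOb)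

theorem finite_polySubmodule (hO : IsOpen O) (hOb : Bornology.IsBounded O) (N : ℕ) :
    FiniteDimensional ℝ (polySubmodule hO hOb N) :=
  have := finite_vanishingPolys (O := O) N
  Module.Finite.map _ _

theorem isClosed_polySubmodule (hO : IsOpen O) (hOb : Bornology.IsBounded O) (N : ℕ) :
    IsClosed (polySubmodule hO hOb N : Set (L2 O × L2V O)) :=
  have := finite_polySubmodule hO hOb N
  Submodule.closed_of_finiteDimensional _

theorem coe_polySubmodule (hO : IsOpen O) (hOb : Bornology.IsBounded O) (N : ℕ) :
    (polySubmodule hO hOb N : Set (L2 O × L2V O)) = polyGraph O N := by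
  ext p
  constructor
  · rintro ⟨a, ⟨h1, h2⟩, rfl⟩
    exact ⟨a, h1, h2, coeFn_polyMap_fst hO hOb a, coeFn_polyMap_snd hO hOb a⟩
  · rintro ⟨a, h1, h2, h3, h4⟩
    exact ⟨a, ⟨h1, h2⟩, Prod.ext (Lp.ext ((coeFn_polyMap_fst hO hOb a).trans h3.symm))
      (Lp.ext ((coeFn_polyMap_snd hO hOb a).trans h4.symm))⟩

theorem memLp_of_mem_polyGraph (hO : IsOpen O) (hOb : Bornology.IsBounded O) {N : ℕ} (q : ℝ≥0∞)
    {p : L2 O × L2V O} (hp : p ∈ polyGraph O N) : MemLp p.1 q (mu O) := by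
  obtain ⟨a, -, -, h, -⟩ := hp
  exact (memLp_congr_ae h).2
    (memLp_of_continuous hOb (contDiff_mvPolynomial_eval a).continuous q hO.measurableSet)

theorem exists_projection (hO : IsOpen O) (hOb : Bornology.IsBounded O) (N : ℕ) :
    ∃ T : L2 O →L[ℝ] L2 O, (∀ u, ‖T u‖ ≤ ‖u‖) ∧ ∀ u, IsProjection N u (T u) := by
  have := finite_polySubmodule hO hOb N
  let K : Submodule ℝ (L2 O) := (polySubmodule hO hOb N).map (LinearMap.fst ℝ _ _)
  refine ⟨K.starProjection, fun u => ?_, fun u => ⟨?_, fun p hp => ?_⟩⟩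
  · exact (ContinuousLinearMap.le_of_opNorm_le _ K.starProjection_norm_le u).trans (by simp)
  · obtain ⟨⟨v, G⟩, h1, h2⟩ := K.starProjection_apply_mem u
    refine ⟨G, ?_⟩
    rw [← h2, ← coe_polySubmodule hO hOb]
    exact h1
  · rw [← coe_polySubmodule hO hOb] at hp
    have h := K.starProjection_inner_eq_zero u p.1 ⟨p, hp, rfl⟩
    rw [inner_sub_left] at h
    linarith

theorem IsProjection.unique (hO : IsOpen O) (hOb : Bornology.IsBounded O) {N : ℕ} {u v v' : L2 O}
    (h : IsProjection N u v) (h' : IsProjection N u v') : v = v' := by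
  obtain ⟨⟨G, hG⟩, h1⟩ := h
  obtain ⟨⟨G', hG'⟩, h1'⟩ := h'
  have h2 : (v - v', G - G') ∈ polyGraph O N := by
    rw [← coe_polySubmodule hO hOb] at hG hG' ⊢
    exact Submodule.sub_mem _ hG hG'
  have h3 : inner ℝ (v - v') (v - v') = 0 := by
    have := (h1 _ h2).trans (h1' _ h2).symm
    rw [inner_sub_left (𝕜 := ℝ) v v']
    exact sub_eq_zero.2 this
  exact sub_eq_zero.1 (inner_self_eq_zero.1 h3)

end Graphs

/-! ### Reduction of both schemes to the variational step -/

section Steps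

variable {d : ℕ} {O : Set (E d)} {f : Polynomial ℝ} {g : ℝ → ℝ} {τ : ℝ≥0} {u dW v : L2 O}

/-- The explicit part `u + τ f(u) / (1 + τ ‖f(u)‖²) + g(u) dW` of a step. -/
noncomputable def explicitPart (τ : ℝ≥0) (h : Admissible f g u dW) : L2 O :=
  u + (τ / taming f τ u) • h.1.toLp _ + h.2.toLp _

theorem coeFn_explicitPart (h : Admissible f g u dW) : ∀ᵐ x ∂(mu O), explicitPart τ h x =
    u x + τ * f.eval (u x) / taming f τ u + g (u x) * dW x := by
  filter_upwards [Lp.coeFn_add (u + (τ / taming f τ u) • h.1.toLp _) (h.2.toLp _),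
    Lp.coeFn_add u ((τ / taming f τ u) • h.1.toLp _),
    Lp.coeFn_smul (τ / taming f τ u) (h.1.toLp _), h.1.coeFn_toLp, h.2.coeFn_toLp]
    with x h1 h2 h3 h4 h5
  rw [explicitPart, h1, Pi.add_apply, h2, Pi.add_apply, h3, Pi.smul_apply, h4, h5, smul_eq_mul]
  ring

/-- A step of a scheme in variational form, on the space with graph `S`. -/
def VariationalStep (S : Submodule ℝ (L2 O × L2V O)) (f : Polynomial ℝ) (g : ℝ → ℝ) (τ : ℝ≥0)
    (u dW v : L2 O) : Prop :=
  ∃ h : Admissible f g u dW, ∃ G : L2V O, (v, G) ∈ S ∧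
    ∀ p ∈ S, inner ℝ v p.1 + τ * inner ℝ G p.2 = inner ℝ (explicitPart τ h) p.1

theorem VariationalStep.unique {S : Submodule ℝ (L2 O × L2V O)} (hτ : 0 < τ) {v' : L2 O}
    (h : VariationalStep S f g τ u dW v) (h' : VariationalStep S f g τ u dW v') : v = v' := by
  obtain ⟨_, G, h1, h2⟩ := h
  obtain ⟨_, G', h1', h2'⟩ := h'
  exact variational_unique S (τ := τ) (by exact_mod_cast hτ) h1 h1' h2 h2'

/-- The Laplacian is recovered from the weak form as `(v - b) / τ`, with `b` the explicit part.
Conversely, the integration by parts identity is closed in the test pair, so it extends from `C_c^∞`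
to `H¹₀`. -/
theorem timeStep_iff (hτ : 0 < τ) :
    TimeStep f g τ u dW v ↔ VariationalStep (h10Submodule O) f g τ u dW v := by
  have hτ' : (τ : ℝ) ≠ 0 := by exact_mod_cast hτ.ne'
  constructor
  · rintro ⟨h, w, ⟨G, hG, hw⟩, heq⟩
    have hv : v = explicitPart τ h + (τ : ℝ) • w := by
      refine Lp.ext ?_
      filter_upwards [heq, coeFn_explicitPart (τ := τ) h,
        Lp.coeFn_add (explicitPart τ h) ((τ : ℝ) • w), Lp.coeFn_smul (τ : ℝ) w] with x h1 h2 h3 h4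
      rw [h3, Pi.add_apply, h2, h4, Pi.smul_apply, smul_eq_mul]
      linarith
    refine ⟨h, G, by rwa [← SetLike.mem_coe, coe_h10Submodule], fun p hp => ?_⟩
    have hp' : p ∈ closure (testGraph O) := by
      rwa [← SetLike.mem_coe, coe_h10Submodule] at hp
    have hw' : inner ℝ G p.2 = -inner ℝ w p.1 := by
      refine closure_minimal (t := {p : L2 O × L2V O | inner ℝ G p.2 = -inner ℝ w p.1}) hw
        (isClosed_eq (by fun_prop) (by fun_prop)) hp'
    rw [hw', hv, inner_add_left (𝕜 := ℝ), real_inner_smul_left]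
    ring
  · rintro ⟨h, G, hG, hS⟩
    refine ⟨h, (τ : ℝ)⁻¹ • (v - explicitPart τ h), ⟨G, ?_, fun p hp => ?_⟩, ?_⟩
    · rwa [← SetLike.mem_coe, coe_h10Submodule] at hG
    · have := hS p (Submodule.le_topologicalClosure _ hp)
      rw [real_inner_smul_left, inner_sub_left (𝕜 := ℝ), ← this]
      field_simp
      ring
    · filter_upwards [coeFn_explicitPart (τ := τ) h,
        Lp.coeFn_smul (τ : ℝ)⁻¹ (v - explicitPart τ h),
        Lp.coeFn_sub v (explicitPart τ h)] with x h2 h3 h4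
      rw [h3, Pi.smul_apply, h4, Pi.sub_apply, h2, smul_eq_mul]
      field_simp
      ring

theorem inner_toLp_eq_integral {X : Type*} [MeasurableSpace X] {μ : Measure X} {φ : X → ℝ}
    (h : MemLp φ 2 μ) (p : Lp ℝ 2 μ) : inner ℝ (h.toLp φ) p = ∫ x, φ x * p x ∂μ := by
  rw [L2.inner_def]
  refine integral_congr_ae ?_
  filter_upwards [h.coeFn_toLp] with x hx
  rw [hx]
  simp [mul_comm]

theorem fullStep_iff (hO : IsOpen O) (hOb : Bornology.IsBounded O) {N : ℕ} :
    FullStep N f g τ u dW v ↔ VariationalStep (polySubmodule hO hOb N) f g τ u dW v := by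
  rw [FullStep, VariationalStep, ← exists_prop]
  refine exists_congr fun h => exists_congr fun G => ?_
  rw [← SetLike.mem_coe, coe_polySubmodule]
  refine and_congr Iff.rfl ?_
  refine forall_congr' fun p => ?_
  rw [← SetLike.mem_coe, coe_polySubmodule]
  refine imp_congr Iff.rfl ?_
  rw [explicitPart, inner_add_left (𝕜 := ℝ), inner_add_left (𝕜 := ℝ), real_inner_smul_left,
    inner_toLp_eq_integral, inner_toLp_eq_integral, inner_sub_left (𝕜 := ℝ), div_mul_eq_mul_div]
  constructor <;> intro h <;> linarith

end Steps

/-! ### Brownian increments and the Wiener series -/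

section BrownianFamily

variable {Ω : Type*} {mΩ : MeasurableSpace Ω} {P : Measure Ω} {𝓕 : Filtration ℝ≥0 mΩ}
  {β : ℕ → ℝ≥0 → Ω → ℝ}

theorem lintegral_enorm_sq_of_hasLaw_gaussianReal {X : Ω → ℝ} {v : ℝ≥0}
    (h : HasLaw X (gaussianReal 0 v) P) : ∫⁻ ω, ‖X ω‖ₑ ^ 2 ∂P = v := by
  have h1 := h.lintegral_comp (f := fun x : ℝ => ‖x‖ₑ ^ 2) (by fun_prop)
  rw [h1, lintegral_enorm_sq_eq_ofReal (X := fun x : ℝ => x) (memLp_id_gaussianReal' 2 (by norm_num))]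
  have h2 := variance_of_integral_eq_zero (X := (id : ℝ → ℝ)) (μ := gaussianReal 0 v) (by fun_prop)
    (by simp)
  rw [variance_id_gaussianReal] at h2
  simp only [id_eq, Real.norm_eq_abs, sq_abs] at h2 ⊢
  rw [← h2]
  simp

theorem IsBrownianFamily.lintegral_increment_sq (hβ : IsBrownianFamily P 𝓕 β) (j : ℕ) {s t : ℝ≥0}
    (hst : s ≤ t) : ∫⁻ ω, ‖β j t ω - β j s ω‖ₑ ^ 2 ∂P = (t - s : ℝ≥0) := by
  have h := (hβ.brownian j).toIsPreBrownianReal.hasLaw_sub t s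
  have h2 : nndist (t : ℝ) (s : ℝ) = t - s := by
    ext
    rw [coe_nndist, Real.dist_eq, NNReal.coe_sub hst, abs_of_nonneg]
    exact sub_nonneg.2 (by exact_mod_cast hst)
  have h3 := lintegral_enorm_sq_of_hasLaw_gaussianReal h
  rw [show nndist t.1 s.1 = t - s from h2] at h3
  exact h3

theorem IsBrownianFamily.integral_increment (hβ : IsBrownianFamily P 𝓕 β) (j : ℕ) (s t : ℝ≥0) :
    ∫ ω, (β j t ω - β j s ω) ∂P = 0 := by
  have h := (hβ.brownian j).toIsPreBrownianReal
  rw [integral_sub (h.integrable_eval t) (h.integrable_eval s), h.integral_eval, h.integral_eval,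
    sub_zero]

theorem IsBrownianFamily.measurable_increment (hβ : IsBrownianFamily P 𝓕 β) (j : ℕ) {s t : ℝ≥0}
    (hst : s ≤ t) : Measurable[𝓕 t] fun ω => β j t ω - β j s ω :=
  (hβ.adapted j t).sub ((hβ.adapted j s).mono (𝓕.mono hst) le_rfl)

theorem IsBrownianFamily.integral_increment_mul (hβ : IsBrownianFamily P 𝓕 β) {i j : ℕ} (hij : i ≠ j)
    {s t : ℝ≥0} (hst : s ≤ t) :
    ∫ ω, (β i t ω - β i s ω) * (β j t ω - β j s ω) ∂P = 0 := by
  have h := (hβ.indep.indepFun hij).comp (φ := fun x : ℝ≥0 → ℝ => x t - x s)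
    (ψ := fun x : ℝ≥0 → ℝ => x t - x s) (by fun_prop) (by fun_prop)
  have hm (j) : AEStronglyMeasurable (fun ω => β j t ω - β j s ω) P :=
    ((hβ.measurable_increment j hst).mono (𝓕.le t) le_rfl).aestronglyMeasurable
  have h2 := h.integral_fun_mul_eq_mul_integral (hm i) (hm j)
  simp only [Function.comp_apply] at h2
  rw [h2, hβ.integral_increment, zero_mul]

variable {U : Type*} [NormedAddCommGroup U] [InnerProductSpace ℝ U] {e : HilbertBasis ℕ ℝ U}
  {q : ℕ → ℝ} {Q : U →L[ℝ] U}

/-- Since `𝐄 ∑ⱼ qⱼ βⱼ(t)² = t ∑ⱼ qⱼ < ∞`, the coefficients are almost surely in `ℓ²`. Thus the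
`tsum` in `wiener` is a genuine sum and not the default value. -/
theorem hasSum_wiener (hβ : IsBrownianFamily P 𝓕 β) (hQ : IsCovariance Q e q) (t : ℝ≥0) :
    ∀ᵐ ω ∂P, HasSum (fun j => (Real.sqrt (q j) * β j t ω) • e j) (wiener e q β t ω) := by
  have hm (j) : Measurable (β j t) := (hβ.adapted j t).mono (𝓕.le t) le_rfl
  have h1 : ∫⁻ ω, ∑' j, ENNReal.ofReal (q j) * ‖β j t ω‖ₑ ^ 2 ∂P ≠ ∞ := by
    rw [lintegral_tsum fun j => (((hm j).enorm.pow_const 2).const_mul _).aemeasurable]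
    have h2 (j) : ∫⁻ ω, ENNReal.ofReal (q j) * ‖β j t ω‖ₑ ^ 2 ∂P = ENNReal.ofReal (q j) * t := by
      rw [lintegral_const_mul _ ((hm j).enorm.pow_const 2),
        lintegral_enorm_sq_of_hasLaw_gaussianReal
          ((hβ.brownian j).toIsPreBrownianReal.hasLaw_eval t)]
    simp_rw [h2]
    rw [ENNReal.tsum_mul_right, ← ENNReal.ofReal_tsum_of_nonneg hQ.nonneg hQ.traceClass]
    exact ENNReal.mul_ne_top ENNReal.ofReal_ne_top ENNReal.coe_ne_top
  have h3 := ae_lt_top' (AEMeasurable.tsum fun j =>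
    (((hm j).enorm.pow_const 2).const_mul (ENNReal.ofReal (q j))).aemeasurable) h1
  filter_upwards [h3] with ω hω
  have h4 : Summable fun j => ‖Real.sqrt (q j) * β j t ω‖ ^ 2 := by
    have := ENNReal.summable_toReal hω.ne
    refine this.congr fun j => ?_
    rw [ENNReal.toReal_mul, ENNReal.toReal_ofReal (hQ.nonneg j), ENNReal.toReal_pow,
      toReal_enorm, norm_mul, mul_pow, Real.norm_eq_abs (√(q j)), sq_abs,
      Real.sq_sqrt (hQ.nonneg j)]
  let F : lp (fun _ : ℕ => ℝ) 2 := ⟨fun j => Real.sqrt (q j) * β j t ω, memℓp_gen (by simpa using h4)⟩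
  exact (e.hasSum_repr_symm F).summable.hasSum

theorem tendsto_increment {d : ℕ} {O : Set (E d)} (ι : U →L[ℝ] L2 O)
    (hβ : IsBrownianFamily P 𝓕 β) (hQ : IsCovariance Q e q) (τ : ℝ≥0) (k : ℕ) :
    ∀ᵐ ω ∂P, Tendsto (fun n => ∑ j ∈ Finset.range n,
      ((β j ((k + 1 : ℕ) * τ) ω - β j (k * τ) ω) * Real.sqrt (q j)) • ι (e j)) atTop
      (𝓝 (increment ι e q β τ k ω)) := by
  filter_upwards [hasSum_wiener hβ hQ ((k + 1 : ℕ) * τ), hasSum_wiener hβ hQ (k * τ)] with ω h1 h2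
  refine ((ι.hasSum (h1.sub h2)).tendsto_sum_nat).congr fun n => ?_
  refine Finset.sum_congr rfl fun j _ => ?_
  rw [← sub_smul, map_smul]
  congr 1
  ring

end BrownianFamily

/-! ### The noise term `g(u) ΔW` -/

/-- Multiplication by `a` need not be bounded on `L²`, but the relation survives pointwise along a
common subsequence. This identifies the limit of the stochastic series with a product of functions.
-/
theorem ae_eq_mul_of_tendsto {X : Type*} [MeasurableSpace X] {μ : Measure X} {S h : ℕ → Lp ℝ 2 μ}
    {S₀ h₀ : Lp ℝ 2 μ} {a : X → ℝ} (hS : Tendsto S atTop (𝓝 S₀)) (hh : Tendsto h atTop (𝓝 h₀))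
    (heq : ∀ n, ∀ᵐ x ∂μ, S n x = a x * h n x) : ∀ᵐ x ∂μ, S₀ x = a x * h₀ x := by
  obtain ⟨ns, hns, h1⟩ := (tendstoInMeasure_of_tendsto_Lp hS).exists_seq_tendsto_ae
  obtain ⟨ms, hms, h2⟩ :=
    (tendstoInMeasure_of_tendsto_Lp (hh.comp hns.tendsto_atTop)).exists_seq_tendsto_ae
  filter_upwards [h1, h2, ae_all_iff.2 heq] with x h1 h2 h3
  refine tendsto_nhds_unique (h1.comp hms.tendsto_atTop) ?_
  refine (h2.const_mul (a x)).congr fun n => ?_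
  simp only [Function.comp_apply, h3]

section NoiseTerm

variable {Ω : Type*} {mΩ : MeasurableSpace Ω} {P : Measure Ω} [IsProbabilityMeasure P]
  {𝓕 : Filtration ℝ≥0 mΩ} {β : ℕ → ℝ≥0 → Ω → ℝ}
  {U : Type*} [NormedAddCommGroup U] [InnerProductSpace ℝ U] {e : HilbertBasis ℕ ℝ U}
  {q : ℕ → ℝ} {Q : U →L[ℝ] U} {d : ℕ} {O : Set (E d)} {ι : U →L[ℝ] L2 O} {g : ℝ → ℝ} {c : ℝ≥0}

/-- The growth bound controls `qⱼ ‖g(u) eⱼ‖²`, hence says something about the mode only if `qⱼ > 0`.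
Measurability comes from the continuous version of `g`. -/
theorem DiffusionAssumption.memLp_mul (hg : DiffusionAssumption ι e q g c)
    [IsFiniteMeasure (mu O)] {j : ℕ} (hj : 0 < q j) (u : L2 O) :
    MemLp (fun x => g (u x) * ι (e j) x) 2 (mu O) := by
  obtain ⟨g', hg', hgg⟩ := exists_continuous_superposition hg.lipschitz
  refine ⟨?_, ?_⟩
  · refine ((hg'.comp_aestronglyMeasurable (Lp.aestronglyMeasurable u)).mul
      (Lp.aestronglyMeasurable (ι (e j)))).congr ?_
    filter_upwards [hgg u] with x hx
    simp [hx]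
  · have h1 : ENNReal.ofReal (q j) * mulNorm ι g u (e j) ^ 2 ≤ (c * ‖u‖ₑ) ^ 2 :=
      (ENNReal.le_tsum j).trans (hg.growth u)
    by_contra h2
    have h3 : mulNorm ι g u (e j) = ∞ := not_lt_top_iff.1 h2
    rw [h3, ENNReal.top_pow two_ne_zero, ENNReal.mul_top (by simpa using hj)] at h1
    exact (ENNReal.pow_lt_top (ENNReal.mul_lt_top ENNReal.coe_lt_top enorm_lt_top)).ne
      (top_le_iff.1 h1)

/-- The noise term `g(u) ΔW` of a step is square integrable, centred given the past, and its
second moment is given by the Itô isometry. -/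
theorem exists_noise_term [IsFiniteMeasure (mu O)] (hβ : IsBrownianFamily P 𝓕 β)
    (hQ : IsCovariance Q e q) (hg : DiffusionAssumption ι e q g c) (τ : ℝ≥0) (k : ℕ)
    {u : Ω → L2 O} (hu : StronglyMeasurable[𝓕 (k * τ)] u) (hu2 : ∫⁻ ω, ‖u ω‖ₑ ^ 2 ∂P < ∞) :
    ∃ Z : Ω → L2 O, StronglyMeasurable[𝓕 ((k + 1 : ℕ) * τ)] Z ∧ MemLp Z 2 P ∧
      (∀ᵐ ω ∂P, ∃ h : MemLp (fun x => g (u ω x) * increment ι e q β τ k ω x) 2 (mu O),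
        Z ω = h.toLp _) ∧
      ∫⁻ ω, ‖Z ω‖ₑ ^ 2 ∂P = τ * ∫⁻ ω, hsNormSq ι e q g (u ω) ∂P ∧
      ∀ X : Ω → L2 O, StronglyMeasurable[𝓕 (k * τ)] X → MemLp X 2 P →
        ∫ ω, inner ℝ (X ω) (Z ω) ∂P = 0 := by
  obtain ⟨g', hg', hgg⟩ := exists_continuous_superposition hg.lipschitz
  choose T hTm hT using fun j => exists_measurable_superposition hg' (ι (e j))
  have hmul {j : ℕ} (hj : 0 < q j) (u : L2 O) :
      MemLp (fun x => g' (u x) * ι (e j) x) 2 (mu O) := by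
    refine (memLp_congr_ae ?_).1 (hg.memLp_mul hj u)
    filter_upwards [hgg u] with x hx
    rw [hx]
  -- If `qⱼ = 0`, then `T j (u ω)` may be a meaningless default; the factor `√qⱼ` removes it.
  let Y : ℕ → Ω → L2 O := fun j ω => Real.sqrt (q j) • T j (u ω)
  have hY (j) : StronglyMeasurable[𝓕 (k * τ)] (Y j) :=
    (hTm j _ u hu).const_smul (Real.sqrt (q j))
  have hYn (j ω) : ‖Y j ω‖ₑ ^ 2 = ENNReal.ofReal (q j) * mulNorm ι g (u ω) (e j) ^ 2 := by
    rcases (hQ.nonneg j).eq_or_lt with h0 | h0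
    · simp [Y, ← h0]
    · simp only [Y]
      rw [hT j _ (hmul h0 (u ω)), enorm_smul, mul_pow, Lp.enorm_toLp]
      congr 1
      · rw [Real.enorm_eq_ofReal (Real.sqrt_nonneg _), ← ENNReal.ofReal_pow (Real.sqrt_nonneg _),
          Real.sq_sqrt h0.le]
      · congr 1
        refine eLpNorm_congr_ae ?_
        filter_upwards [hgg (u ω)] with x hx
        rw [hx]
  have hYsum : ∑' j, ∫⁻ ω, ‖Y j ω‖ₑ ^ 2 ∂P = ∫⁻ ω, hsNormSq ι e q g (u ω) ∂P := by
    rw [← lintegral_tsum fun j => (((hY j).mono (𝓕.le _)).enorm.pow_const 2).aemeasurable]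
    simp_rw [hYn]
    rfl
  have hYfin : ∑' j, ∫⁻ ω, ‖Y j ω‖ₑ ^ 2 ∂P ≠ ∞ := by
    rw [hYsum]
    refine ((lintegral_mono fun ω => hg.growth (u ω)).trans_lt ?_).ne
    simp_rw [mul_pow]
    rw [lintegral_const_mul _ ((hu.mono (𝓕.le _)).enorm.pow_const 2)]
    exact ENNReal.mul_lt_top (by simp) hu2
  have hst : (k * τ : ℝ≥0) ≤ (k + 1 : ℕ) * τ := by gcongr; simp
  have hτ : ((k + 1 : ℕ) * τ - k * τ : ℝ≥0) = τ := by
    push_cast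
    rw [add_mul, one_mul, add_tsub_cancel_left]
  obtain ⟨Z, hZm, ⟨ns, hns, hlim⟩, hZ2, hZn, hZo⟩ := exists_stochastic_increment (P := P)
    (𝓕.mono hst) (𝓕.le _) (ξ := fun j ω => β j ((k + 1 : ℕ) * τ) ω - β j (k * τ) ω)
    (fun j => hβ.measurable_increment j hst) (fun j => hβ.integral_increment j _ _)
    (fun j => hβ.lintegral_increment_sq j hst) (fun i j hij => hβ.integral_increment_mul hij hst)
    (hβ.indep_past _ _ hst) hY hYfin
  rw [hτ, hYsum] at hZn
  refine ⟨Z, hZm, hZ2, ?_, hZn, hZo⟩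
  filter_upwards [hlim, tendsto_increment ι hβ hQ τ k] with ω h1 h2
  have key : ∀ᵐ x ∂(mu O), Z ω x = g' (u ω x) * increment ι e q β τ k ω x := by
    refine ae_eq_mul_of_tendsto h1 (h2.comp hns.tendsto_atTop) fun n => ?_
    have h3 : ∀ᵐ x ∂(mu O), ∀ j, ((β j ((k + 1 : ℕ) * τ) ω - β j (k * τ) ω) • Y j ω) x =
        g' (u ω x) * (((β j ((k + 1 : ℕ) * τ) ω - β j (k * τ) ω) * Real.sqrt (q j)) •
          ι (e j)) x := by
      refine ae_all_iff.2 fun j => ?_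
      rcases (hQ.nonneg j).eq_or_lt with h0 | h0
      · simp only [Y, ← h0, Real.sqrt_zero, zero_smul, smul_zero, mul_zero]
        filter_upwards [Lp.coeFn_zero ℝ 2 (mu O)] with x hx
        rw [hx, Pi.zero_apply, mul_zero]
      · simp only [Y, hT j _ (hmul h0 (u ω)), smul_smul]
        filter_upwards [Lp.coeFn_smul ((β j ((k + 1 : ℕ) * τ) ω - β j (k * τ) ω) *
          Real.sqrt (q j)) ((hmul h0 (u ω)).toLp _), (hmul h0 (u ω)).coeFn_toLp,
          Lp.coeFn_smul ((β j ((k + 1 : ℕ) * τ) ω - β j (k * τ) ω) *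
          Real.sqrt (q j)) (ι (e j))] with x e1 e2 e3
        rw [e1, e3, Pi.smul_apply, Pi.smul_apply, e2, smul_eq_mul, smul_eq_mul]
        ring
    simp only [Function.comp_apply]
    filter_upwards [h3, coeFn_sum_range (fun j =>
        (β j ((k + 1 : ℕ) * τ) ω - β j (k * τ) ω) • Y j ω) (ns n),
      coeFn_sum_range (fun j => ((β j ((k + 1 : ℕ) * τ) ω - β j (k * τ) ω) * Real.sqrt (q j)) •
        ι (e j)) (ns n)] with x e1 e2 e3
    rw [e2, e3, Finset.mul_sum]
    exact Finset.sum_congr rfl fun j _ => e1 j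
  have key2 : Z ω =ᵐ[mu O] fun x => g (u ω x) * increment ι e q β τ k ω x := by
    filter_upwards [key, hgg (u ω)] with x h3 h4
    rw [h3, h4]
  have hmem := (memLp_congr_ae key2).1 (Lp.memLp (Z ω))
  exact ⟨hmem, Lp.ext (key2.trans hmem.coeFn_toLp.symm)⟩

end NoiseTerm

/-! ### The energy inequality of one step -/

theorem lintegral_enorm_add_sq_of_orthogonal {Ω H : Type*} {mΩ : MeasurableSpace Ω}
    {P : Measure Ω} [NormedAddCommGroup H] [InnerProductSpace ℝ H] {X Z : Ω → H}
    (hX : MemLp X 2 P) (hZ : MemLp Z 2 P) (h : ∫ ω, inner ℝ (X ω) (Z ω) ∂P = 0) :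
    ∫⁻ ω, ‖X ω + Z ω‖ₑ ^ 2 ∂P = ∫⁻ ω, ‖X ω‖ₑ ^ 2 ∂P + ∫⁻ ω, ‖Z ω‖ₑ ^ 2 ∂P := by
  have hXZ : MemLp (fun ω => X ω + Z ω) 2 P := hX.add hZ
  have i1 := hX.norm.integrable_sq
  have i2 := hZ.norm.integrable_sq
  have i3 : Integrable (fun ω => inner ℝ (X ω) (Z ω)) P := by
    refine (L2.integrable_inner (𝕜 := ℝ) (hX.toLp X) (hZ.toLp Z)).congr ?_
    filter_upwards [hX.coeFn_toLp, hZ.coeFn_toLp] with ω h1 h2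
    rw [h1, h2]
  rw [lintegral_enorm_sq_eq_ofReal hXZ, lintegral_enorm_sq_eq_ofReal hX,
    lintegral_enorm_sq_eq_ofReal hZ, ← ENNReal.ofReal_add (integral_nonneg fun _ => sq_nonneg _)
    (integral_nonneg fun _ => sq_nonneg _)]
  congr 1
  simp_rw [norm_add_sq_real]
  have i4 : Integrable (fun ω => ‖X ω‖ ^ 2 + 2 * inner ℝ (X ω) (Z ω)) P := i1.add (i3.const_mul 2)
  rw [integral_add i4 i2, integral_add i1 (i3.const_mul 2), integral_const_mul, h]
  ring

theorem exists_measurable_nemytskii {X : Type*} [MeasurableSpace X] {μ : Measure X}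
    [IsFiniteMeasure μ] {φ : ℝ → ℝ} (hφ : Continuous φ) :
    ∃ T : Lp ℝ 2 μ → Lp ℝ 2 μ,
      (∀ {Ω : Type*} (m : MeasurableSpace Ω) (Y : Ω → Lp ℝ 2 μ), StronglyMeasurable[m] Y →
        StronglyMeasurable[m] fun ω => T (Y ω)) ∧
      ∀ (u : Lp ℝ 2 μ) (hu : MemLp (fun x => φ (u x)) 2 μ), T u = hu.toLp _ := by
  obtain ⟨T, h1, h2⟩ := exists_measurable_superposition hφ ((memLp_const (1 : ℝ)).toLp _ : Lp ℝ 2 μ)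
  refine ⟨T, h1, fun u hu => ?_⟩
  have h3 : (fun x => φ (u x) * ((memLp_const (1 : ℝ)).toLp _ : Lp ℝ 2 μ) x) =ᵐ[μ]
      fun x => φ (u x) := by
    filter_upwards [(memLp_const (μ := μ) (p := 2) (1 : ℝ)).coeFn_toLp] with x hx
    rw [hx, mul_one]
  rw [h2 u ((memLp_congr_ae h3).2 hu), MemLp.toLp_eq_toLp_iff]
  exact h3

/-- With `D = 1 + τ‖F‖²`, the cross term costs at most `2τK‖u‖²` because `τ / D ≤ τ`, while the
quadratic term equals `τ (D - 1) / D² ≤ τ` however large `F` is. This is why no restriction on `τ`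
is needed. -/
theorem norm_tamed_sq_le {H : Type*} [NormedAddCommGroup H] [InnerProductSpace ℝ H] {u F : H}
    {τ K : ℝ} (hτ : 0 ≤ τ) (hK : 0 ≤ K) (hF : inner ℝ F u ≤ K * ‖u‖ ^ 2) :
    ‖u + (τ / (1 + τ * ‖F‖ ^ 2)) • F‖ ^ 2 ≤ (1 + 2 * τ * K) * ‖u‖ ^ 2 + τ := by
  set D := 1 + τ * ‖F‖ ^ 2 with hD
  have hD1 : 1 ≤ D := by rw [hD]; nlinarith [mul_nonneg hτ (sq_nonneg ‖F‖)]
  have hD0 : 0 < D := by linarith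
  rw [norm_add_sq_real, inner_smul_right, norm_smul, mul_pow, Real.norm_eq_abs, sq_abs,
    real_inner_comm]
  have hε : τ / D ≤ τ := div_le_self hτ hD1
  have h1 : τ / D * inner ℝ F u ≤ τ * (K * ‖u‖ ^ 2) :=
    (mul_le_mul_of_nonneg_left hF (div_nonneg hτ hD0.le)).trans
      (mul_le_mul_of_nonneg_right hε (by positivity))
  have h2 : (τ / D) ^ 2 * ‖F‖ ^ 2 ≤ τ := by
    have h3 : (τ / D) ^ 2 * ‖F‖ ^ 2 = τ * ((D - 1) / D ^ 2) := by
      rw [hD]; field_simp; ring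
    have h4 : (D - 1) / D ^ 2 ≤ 1 := by
      rw [div_le_one (by positivity)]; nlinarith
    rw [h3]
    exact mul_le_of_le_one_right hτ h4
  linarith

theorem DriftAssumption.inner_le {d : ℕ} {O : Set (E d)} {f : Polynomial ℝ} {θ α K L : ℝ}
    (hf : DriftAssumption O f θ α K L) {u : L2 O}
    (hu : MemLp u ((2 * f.natDegree : ℕ) : ℝ≥0∞) (mu O))
    (h : MemLp (fun x => f.eval (u x)) 2 (mu O)) : inner ℝ (h.toLp _) u ≤ K * ‖u‖ ^ 2 := by
  rw [inner_toLp_eq_integral]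
  have h1 := hf.coercive u hu
  have h2 : nrm O u = ‖u‖ := rfl
  rw [h2] at h1
  have h3 : 0 ≤ θ * ‖u‖ ^ α := mul_nonneg hf.theta_pos.le (Real.rpow_nonneg (norm_nonneg _) _)
  linarith

theorem taming_eq {d : ℕ} {O : Set (E d)} {f : Polynomial ℝ} {τ : ℝ≥0} {u : L2 O}
    (h : MemLp (fun x => f.eval (u x)) 2 (mu O)) :
    taming f τ u = 1 + τ * ‖h.toLp _‖ ^ 2 := by
  rw [taming, ← real_inner_self_eq_norm_sq, inner_toLp_eq_integral]
  congr 2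
  refine integral_congr_ae ?_
  filter_upwards [h.coeFn_toLp] with x hx
  rw [hx, sq]

/-- Polarization, `2⟪b, v⟫ = ‖b‖² + ‖v‖² - ‖b - v‖²`, with the last square dropped; it yields the
factor `2` on the gradient term. -/
theorem enorm_sq_add_le_of_variational {H V : Type*} [NormedAddCommGroup H]
    [InnerProductSpace ℝ H] [NormedAddCommGroup V] [InnerProductSpace ℝ V] {τ : ℝ≥0} {v b : H}
    {G : V} (h : inner ℝ v v + τ * inner ℝ G G = inner ℝ b v) :
    ‖v‖ₑ ^ 2 + 2 * τ * ‖G‖ₑ ^ 2 ≤ ‖b‖ₑ ^ 2 := by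
  rw [real_inner_self_eq_norm_sq, real_inner_self_eq_norm_sq] at h
  have h1 : ‖v‖ ^ 2 + 2 * τ * ‖G‖ ^ 2 ≤ ‖b‖ ^ 2 := by
    have h2 := norm_sub_sq_real b v
    nlinarith [sq_nonneg ‖b - v‖]
  have h3 := ENNReal.ofReal_le_ofReal h1
  rwa [ENNReal.ofReal_add (by positivity) (by positivity), ENNReal.ofReal_mul (by positivity),
    ENNReal.ofReal_mul (by positivity), ENNReal.ofReal_pow (norm_nonneg _),
    ENNReal.ofReal_pow (norm_nonneg _), ENNReal.ofReal_pow (norm_nonneg _), ofReal_norm,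
    ofReal_norm, ofReal_norm, ENNReal.ofReal_coe_nnreal, ENNReal.ofReal_ofNat] at h3

section Step

variable {Ω : Type*} {mΩ : MeasurableSpace Ω} {P : Measure Ω} [IsProbabilityMeasure P]
  {𝓕 : Filtration ℝ≥0 mΩ} {β : ℕ → ℝ≥0 → Ω → ℝ}
  {U : Type*} [NormedAddCommGroup U] [InnerProductSpace ℝ U] {e : HilbertBasis ℕ ℝ U}
  {q : ℕ → ℝ} {Q : U →L[ℝ] U} {d : ℕ} {O : Set (E d)} {ι : U →L[ℝ] L2 O} {g : ℝ → ℝ} {c : ℝ≥0}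
  {f : Polynomial ℝ} {θ α K L : ℝ}

/-- Existence of an adapted step of the scheme on the space with graph `S`, and the energy
inequality of that step. -/
theorem exists_step [IsFiniteMeasure (mu O)] (hβ : IsBrownianFamily P 𝓕 β)
    (hQ : IsCovariance Q e q) (hf : DriftAssumption O f θ α K L)
    (hg : DiffusionAssumption ι e q g c) {S : Submodule ℝ (L2 O × L2V O)}
    (hS : IsClosed (S : Set (L2 O × L2V O)))
    (hSp : ∀ p ∈ S, MemLp p.1 ((2 * f.natDegree : ℕ) : ℝ≥0∞) (mu O)) {τ : ℝ≥0} (hτ : 0 < τ) (k : ℕ)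
    {u : Ω → L2 O} (hu : StronglyMeasurable[𝓕 (k * τ)] u) (hu2 : ∫⁻ ω, ‖u ω‖ₑ ^ 2 ∂P < ∞)
    (hup : ∀ᵐ ω ∂P, MemLp (u ω) ((2 * f.natDegree : ℕ) : ℝ≥0∞) (mu O)) :
    ∃ v : Ω → L2 O, StronglyMeasurable[𝓕 ((k + 1 : ℕ) * τ)] v ∧ ∫⁻ ω, ‖v ω‖ₑ ^ 2 ∂P < ∞ ∧
      (∀ᵐ ω ∂P, MemLp (v ω) ((2 * f.natDegree : ℕ) : ℝ≥0∞) (mu O)) ∧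
      (∀ᵐ ω ∂P, VariationalStep S f g τ (u ω) (increment ι e q β τ k ω) (v ω)) ∧
      ∀ κ : ℝ, 0 ≤ κ → (∀ u : L2 O, hsNormSq ι e q g u ≤ ENNReal.ofReal κ * ‖u‖ₑ ^ 2) →
        ∫⁻ ω, ‖v ω‖ₑ ^ 2 ∂P + 2 * τ * ∫⁻ ω, gradSq (S : Set (L2 O × L2V O)) (v ω) ∂P ≤
          ENNReal.ofReal (1 + (2 * K + 2 * κ) * τ) * ∫⁻ ω, ‖u ω‖ₑ ^ 2 ∂P + τ := by
  obtain ⟨R, hR⟩ := exists_variational_resolvent S hS (τ := τ) (by exact_mod_cast hτ)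
  obtain ⟨T, hTm, hT⟩ := exists_measurable_nemytskii (μ := mu O) (φ := fun y => f.eval y)
    f.continuous
  obtain ⟨Z, hZm, hZ2, hZ, hZn, hZo⟩ := exists_noise_term hβ hQ hg τ k hu hu2
  have hst : (k * τ : ℝ≥0) ≤ (k + 1 : ℕ) * τ := by gcongr; simp
  -- `T` replaces `f` so that `X` is measurable at time `t_k` on all of `Ω`; it agrees with the
  -- tamed drift step almost surely.
  let X : Ω → L2 O := fun ω => u ω + ((τ : ℝ) / (1 + τ * ‖T (u ω)‖ ^ 2)) • T (u ω)
  have hFm : StronglyMeasurable[𝓕 (k * τ)] fun ω => T (u ω) := hTm _ u hu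
  have hXm : StronglyMeasurable[𝓕 (k * τ)] X := by
    have hc : StronglyMeasurable[𝓕 (k * τ)] fun ω => (τ : ℝ) / (1 + τ * ‖T (u ω)‖ ^ 2) :=
      (measurable_const.div
        (measurable_const.add ((hFm.norm.measurable.pow_const 2).const_mul _))).stronglyMeasurable
    exact hu.add (hc.smul hFm)
  let b : Ω → L2 O := fun ω => X ω + Z ω
  have hbm : StronglyMeasurable[𝓕 ((k + 1 : ℕ) * τ)] b := (hXm.mono (𝓕.mono hst)).add hZm
  let v : Ω → L2 O := fun ω => (R (b ω)).1
  let G : Ω → L2V O := fun ω => (R (b ω)).2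
  have hvm : StronglyMeasurable[𝓕 ((k + 1 : ℕ) * τ)] v :=
    (continuous_fst.comp R.continuous).comp_stronglyMeasurable hbm
  have hGm : StronglyMeasurable[𝓕 ((k + 1 : ℕ) * τ)] G :=
    (continuous_snd.comp R.continuous).comp_stronglyMeasurable hbm
  have hadm : ∀ᵐ ω ∂P, ∃ h : Admissible f g (u ω) (increment ι e q β τ k ω),
      b ω = explicitPart τ h := by
    filter_upwards [hup, hZ] with ω h1 h2
    obtain ⟨h2, h3⟩ := h2
    have h4 := memLp_polynomial_eval f h1
    refine ⟨⟨h4, h2⟩, ?_⟩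
    change u ω + ((τ : ℝ) / (1 + τ * ‖T (u ω)‖ ^ 2)) • T (u ω) + Z ω = _
    rw [hT _ h4, ← taming_eq h4, h3]
    rfl
  have hXle : ∀ᵐ ω ∂P, ‖X ω‖ₑ ^ 2 ≤ ENNReal.ofReal (1 + 2 * τ * K) * ‖u ω‖ₑ ^ 2 + τ := by
    filter_upwards [hup] with ω h1
    have h4 := memLp_polynomial_eval f h1
    have h5 := norm_tamed_sq_le (τ := τ) τ.coe_nonneg hf.K_pos.le (hf.inner_le h1 h4)
    have hc : 0 ≤ 1 + 2 * (τ : ℝ) * K := by have := hf.K_pos; positivity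
    rw [← hT _ h4] at h5
    have h6 := ENNReal.ofReal_le_ofReal h5
    rwa [ENNReal.ofReal_add (by positivity) τ.coe_nonneg, ENNReal.ofReal_mul hc,
      ENNReal.ofReal_pow (norm_nonneg _), ENNReal.ofReal_pow (norm_nonneg _), ofReal_norm,
      ofReal_norm, ENNReal.ofReal_coe_nnreal] at h6
  have hum : Measurable fun ω => ‖u ω‖ₑ ^ 2 := (hu.mono (𝓕.le _)).enorm.pow_const 2
  have hXle' : ∫⁻ ω, ‖X ω‖ₑ ^ 2 ∂P ≤
      ENNReal.ofReal (1 + 2 * τ * K) * ∫⁻ ω, ‖u ω‖ₑ ^ 2 ∂P + τ := by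
    refine (lintegral_mono_ae hXle).trans (le_of_eq ?_)
    rw [lintegral_add_right _ measurable_const, lintegral_const_mul _ hum]
    simp
  have hX2 : MemLp X 2 P := memLp_two_of_lintegral_lt_top (hXm.mono (𝓕.le _)).aestronglyMeasurable
    (hXle'.trans_lt (ENNReal.add_lt_top.2
      ⟨ENNReal.mul_lt_top ENNReal.ofReal_lt_top hu2, ENNReal.coe_lt_top⟩))
  have hb : ∫⁻ ω, ‖b ω‖ₑ ^ 2 ∂P = ∫⁻ ω, ‖X ω‖ₑ ^ 2 ∂P + ∫⁻ ω, ‖Z ω‖ₑ ^ 2 ∂P :=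
    lintegral_enorm_add_sq_of_orthogonal hX2 hZ2 (hZo X hXm hX2)
  have hvG (ω) : ‖v ω‖ₑ ^ 2 + 2 * τ * ‖G ω‖ₑ ^ 2 ≤ ‖b ω‖ₑ ^ 2 :=
    enorm_sq_add_le_of_variational ((hR (b ω)).2 _ (hR (b ω)).1)
  have hb2 : MemLp b 2 P := hX2.add hZ2
  refine ⟨v, hvm, ?_, Eventually.of_forall fun ω => hSp _ (hR (b ω)).1, ?_, fun κ hκ0 hκ => ?_⟩
  · refine (lintegral_mono fun ω => le_self_add.trans (hvG ω)).trans_lt ?_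
    rw [lintegral_enorm_sq_eq_ofReal hb2]
    exact ENNReal.ofReal_lt_top
  · filter_upwards [hadm] with ω h
    obtain ⟨h, hbω⟩ := h
    refine ⟨h, G ω, (hR (b ω)).1, fun p hp => ?_⟩
    rw [← hbω]
    exact (hR (b ω)).2 p hp
  -- Replacing the infimum `gradSq` by the measurable `‖G‖²` before the integrals are combined
  -- avoids any question of its measurability.
  · have h1 : ∫⁻ ω, gradSq (S : Set (L2 O × L2V O)) (v ω) ∂P ≤ ∫⁻ ω, ‖G ω‖ₑ ^ 2 ∂P :=
      lintegral_mono fun ω => iInf₂_le (G ω) (hR (b ω)).1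
    have hGm' : Measurable fun ω => ‖G ω‖ₑ ^ 2 := (hGm.mono (𝓕.le _)).enorm.pow_const 2
    calc ∫⁻ ω, ‖v ω‖ₑ ^ 2 ∂P + 2 * τ * ∫⁻ ω, gradSq (S : Set (L2 O × L2V O)) (v ω) ∂P
        ≤ ∫⁻ ω, ‖v ω‖ₑ ^ 2 ∂P + 2 * τ * ∫⁻ ω, ‖G ω‖ₑ ^ 2 ∂P := by gcongr
      _ = ∫⁻ ω, (‖v ω‖ₑ ^ 2 + 2 * τ * ‖G ω‖ₑ ^ 2) ∂P := by
        rw [lintegral_add_right _ (hGm'.const_mul _), lintegral_const_mul _ hGm']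
      _ ≤ ∫⁻ ω, ‖b ω‖ₑ ^ 2 ∂P := lintegral_mono hvG
      _ = ∫⁻ ω, ‖X ω‖ₑ ^ 2 ∂P + τ * ∫⁻ ω, hsNormSq ι e q g (u ω) ∂P := by rw [hb, hZn]
      _ ≤ (ENNReal.ofReal (1 + 2 * τ * K) * ∫⁻ ω, ‖u ω‖ₑ ^ 2 ∂P + τ) +
          τ * ∫⁻ ω, ENNReal.ofReal κ * ‖u ω‖ₑ ^ 2 ∂P := by
        gcongr with ω
        exact hκ _
      _ = ENNReal.ofReal (1 + (2 * K + κ) * τ) * ∫⁻ ω, ‖u ω‖ₑ ^ 2 ∂P + τ := by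
        have hK := hf.K_pos
        rw [lintegral_const_mul _ hum, ← mul_assoc, add_right_comm, ← add_mul]
        congr 2
        rw [← ENNReal.ofReal_coe_nnreal, ← ENNReal.ofReal_mul τ.coe_nonneg, ← ENNReal.ofReal_add
          (by positivity) (by positivity)]
        congr 1
        ring
      -- The energy argument yields only `κ` here; passing to `2κ` matches the claimed exponent.
      _ ≤ ENNReal.ofReal (1 + (2 * K + 2 * κ) * τ) * ∫⁻ ω, ‖u ω‖ₑ ^ 2 ∂P + τ := by
        gcongr
        linarith

end Step

/-! ### Gronwall's inequality and induction over the steps -/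

/-- A discrete Gronwall inequality for `aₖ + ∑_{j < k} bⱼ`. -/
theorem discrete_gronwall {a b : ℕ → ℝ≥0∞} {lam : ℝ} {τ : ℝ≥0} (hlam : 0 < lam)
    (h : ∀ k, a (k + 1) + b k ≤ ENNReal.ofReal (1 + lam * τ) * a k + τ) (k : ℕ) :
    a k + ∑ j ∈ Finset.range k, b j ≤ ENNReal.ofReal ((1 + lam * τ) ^ k) * a 0 +
      ENNReal.ofReal (((1 + lam * τ) ^ k - 1) / lam) := by
  have hE : 1 ≤ 1 + lam * τ := by have : 0 ≤ lam * τ := by positivity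
                                  linarith
  have hE0 : 0 ≤ 1 + lam * τ := by linarith
  induction k with
  | zero => simp
  | succ k ih =>
    have hnn : 0 ≤ ((1 + lam * τ) ^ k - 1) / lam :=
      div_nonneg (sub_nonneg.2 (one_le_pow₀ hE)) hlam.le
    calc a (k + 1) + ∑ j ∈ Finset.range (k + 1), b j
        = (a (k + 1) + b k) + ∑ j ∈ Finset.range k, b j := by
          rw [Finset.sum_range_succ]; ring
      _ ≤ (ENNReal.ofReal (1 + lam * τ) * a k + τ) +
          ENNReal.ofReal (1 + lam * τ) * ∑ j ∈ Finset.range k, b j := by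
        -- The earlier `b j` may be multiplied by `1 + lam * τ ≥ 1`, so that the combined quantity
        -- satisfies the recursion.
        refine add_le_add (h k) ?_
        exact le_mul_of_one_le_left zero_le (ENNReal.one_le_ofReal.2 hE)
      _ = ENNReal.ofReal (1 + lam * τ) * (a k + ∑ j ∈ Finset.range k, b j) + τ := by ring
      _ ≤ ENNReal.ofReal (1 + lam * τ) * (ENNReal.ofReal ((1 + lam * τ) ^ k) * a 0 +
          ENNReal.ofReal (((1 + lam * τ) ^ k - 1) / lam)) + τ := by gcongr
      _ = ENNReal.ofReal ((1 + lam * τ) ^ (k + 1)) * a 0 +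
          ENNReal.ofReal (((1 + lam * τ) ^ (k + 1) - 1) / lam) := by
        rw [mul_add, ← mul_assoc, ← ENNReal.ofReal_mul hE0, ← ENNReal.ofReal_mul hE0, ← pow_succ',
          add_assoc, ← ENNReal.ofReal_coe_nnreal (p := τ), ← ENNReal.ofReal_add (by positivity) τ.coe_nonneg]
        -- Geometric sum: with `r = 1 + lam * τ`, one has `τ = (r - 1) / lam`, so `r (r ^ k - 1) /
        -- lam + τ = (r ^ (k + 1) - 1) / lam`.
        congr 2
        field_simp
        ring

section Scheme

variable {Ω : Type*} {mΩ : MeasurableSpace Ω} {P : Measure Ω}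
  {𝓕 : Filtration ℝ≥0 mΩ} {β : ℕ → ℝ≥0 → Ω → ℝ}
  {U : Type*} [NormedAddCommGroup U] [InnerProductSpace ℝ U] {e : HilbertBasis ℕ ℝ U}
  {q : ℕ → ℝ} {Q : U →L[ℝ] U} {d : ℕ} {O : Set (E d)} {ι : U →L[ℝ] L2 O} {g : ℝ → ℝ} {c : ℝ≥0}
  {f : Polynomial ℝ} {θ α K L : ℝ}

theorem Stable.congr {S : Set (L2 O × L2V O)} {τ : ℝ≥0} {M : ℕ} {κ : ℝ} {u v : ℕ → Ω → L2 O}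
    (h : Stable P S τ M K κ u) (huv : ∀ k ≤ M, u k =ᵐ[P] v k) : Stable P S τ M K κ v := by
  intro k hk
  have h1 := h k hk
  have e1 {k : ℕ} (hk : k ≤ M) : ∫⁻ ω, ‖u k ω‖ₑ ^ 2 ∂P = ∫⁻ ω, ‖v k ω‖ₑ ^ 2 ∂P := by
    refine lintegral_congr_ae ?_
    filter_upwards [huv k hk] with ω hω
    rw [hω]
  have e2 : ∑ j ∈ Finset.range (k + 1), ∫⁻ ω, gradSq S (u (j + 1) ω) ∂P =
      ∑ j ∈ Finset.range (k + 1), ∫⁻ ω, gradSq S (v (j + 1) ω) ∂P := by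
    refine Finset.sum_congr rfl fun j hj => lintegral_congr_ae ?_
    have : j + 1 ≤ M := by have := Finset.mem_range.1 hj; omega
    filter_upwards [huv _ this] with ω hω
    rw [hω]
  rwa [e1 hk, e1 (Nat.zero_le M), e2] at h1

theorem stable_of_step {S : Set (L2 O × L2V O)} {τ : ℝ≥0} (M : ℕ) {κ : ℝ} (hK : 0 < K) (hκ : 0 ≤ κ)
    {u : ℕ → Ω → L2 O}
    (h : ∀ k, ∫⁻ ω, ‖u (k + 1) ω‖ₑ ^ 2 ∂P + 2 * τ * ∫⁻ ω, gradSq S (u (k + 1) ω) ∂P ≤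
      ENNReal.ofReal (1 + (2 * K + 2 * κ) * τ) * ∫⁻ ω, ‖u k ω‖ₑ ^ 2 ∂P + τ) :
    Stable P S τ M K κ u := by
  intro k hk
  have hlam : 0 < 2 * K + 2 * κ := by linarith
  have hG := discrete_gronwall (a := fun k => ∫⁻ ω, ‖u k ω‖ₑ ^ 2 ∂P)
    (b := fun k => 2 * τ * ∫⁻ ω, gradSq S (u (k + 1) ω) ∂P) hlam h (k + 1)
  rw [← Finset.mul_sum] at hG
  have hnn : 0 ≤ (2 * K + 2 * κ) * τ := by positivity
  have hpow : (1 + (2 * K + 2 * κ) * τ) ^ (k + 1) ≤ Real.exp ((2 * K + 2 * κ) * (M * τ)) := by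
    calc (1 + (2 * K + 2 * κ) * τ) ^ (k + 1) ≤ Real.exp ((2 * K + 2 * κ) * τ) ^ (k + 1) := by
          gcongr
          linarith [Real.add_one_le_exp ((2 * K + 2 * κ) * τ)]
      _ = Real.exp ((k + 1 : ℕ) * ((2 * K + 2 * κ) * τ)) := (Real.exp_nat_mul _ _).symm
      _ ≤ Real.exp ((2 * K + 2 * κ) * (M * τ)) := by
        refine Real.exp_le_exp.2 ?_
        have h1 : ((k + 1 : ℕ) : ℝ) ≤ M := by exact_mod_cast hk
        calc ((k + 1 : ℕ) : ℝ) * ((2 * K + 2 * κ) * τ) ≤ M * ((2 * K + 2 * κ) * τ) := by gcongr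
          _ = (2 * K + 2 * κ) * (M * τ) := by ring
  refine hG.trans (add_le_add ?_ (ENNReal.ofReal_le_ofReal ?_))
  · gcongr
  -- Gronwall gives the denominator `2 (K + κ)`; a factor `2` is given away.
  · exact div_le_div₀ (Real.exp_pos _).le (by linarith) (by linarith) (by linarith)

/-- Unique solvability and stability of the scheme with a given initial value, on the space with
graph `S`. -/
theorem uniquelySolvable_and_stable [IsProbabilityMeasure P] [IsFiniteMeasure (mu O)] (hβ : IsBrownianFamily P 𝓕 β)
    (hQ : IsCovariance Q e q) (hf : DriftAssumption O f θ α K L)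
    (hg : DiffusionAssumption ι e q g c) {S : Submodule ℝ (L2 O × L2V O)}
    (hS : IsClosed (S : Set (L2 O × L2V O)))
    (hSp : ∀ p ∈ S, MemLp p.1 ((2 * f.natDegree : ℕ) : ℝ≥0∞) (mu O)) {τ : ℝ≥0} (hτ : 0 < τ) (M : ℕ)
    {w : Ω → L2 O} (hw : StronglyMeasurable[𝓕 0] w) (hw2 : ∫⁻ ω, ‖w ω‖ₑ ^ 2 ∂P < ∞)
    (hwp : ∀ᵐ ω ∂P, MemLp (w ω) ((2 * f.natDegree : ℕ) : ℝ≥0∞) (mu O))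
    {IsSol : (ℕ → Ω → L2 O) → Prop}
    (hSol : ∀ u, IsSol u ↔ u 0 =ᵐ[P] w ∧ ∀ k < M, ∀ᵐ ω ∂P,
      VariationalStep S f g τ (u k ω) (increment ι e q β τ k ω) (u (k + 1) ω)) :
    UniquelySolvable P 𝓕 τ M IsSol ∧ ∀ u, IsSol u → ∀ κ : ℝ, 0 ≤ κ →
      (∀ u : L2 O, hsNormSq ι e q g u ≤ ENNReal.ofReal κ * ‖u‖ₑ ^ 2) →
        Stable P (S : Set (L2 O × L2V O)) τ M K κ u := by
  let Good : ℕ → (Ω → L2 O) → Prop := fun k u => StronglyMeasurable[𝓕 (k * τ)] u ∧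
    ∫⁻ ω, ‖u ω‖ₑ ^ 2 ∂P < ∞ ∧ ∀ᵐ ω ∂P, MemLp (u ω) ((2 * f.natDegree : ℕ) : ℝ≥0∞) (mu O)
  -- `Good` is the invariant of the recursion. Placing it as a premise after `∃ v` makes the chosen
  -- step map total, so the iteration can be defined before the invariant is proved.
  have hstep : ∀ k u, ∃ v, Good k u → Good (k + 1) v ∧
      (∀ᵐ ω ∂P, VariationalStep S f g τ (u ω) (increment ι e q β τ k ω) (v ω)) ∧
      ∀ κ : ℝ, 0 ≤ κ → (∀ u : L2 O, hsNormSq ι e q g u ≤ ENNReal.ofReal κ * ‖u‖ₑ ^ 2) →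
        ∫⁻ ω, ‖v ω‖ₑ ^ 2 ∂P + 2 * τ * ∫⁻ ω, gradSq (S : Set (L2 O × L2V O)) (v ω) ∂P ≤
          ENNReal.ofReal (1 + (2 * K + 2 * κ) * τ) * ∫⁻ ω, ‖u ω‖ₑ ^ 2 ∂P + τ := by
    intro k u
    by_cases hu : Good k u
    · obtain ⟨v, h1, h2, h3, h4, h5⟩ := exists_step hβ hQ hf hg hS hSp hτ k hu.1 hu.2.1 hu.2.2
      exact ⟨v, fun _ => ⟨⟨h1, h2, h3⟩, h4, h5⟩⟩
    · exact ⟨u, fun h => absurd h hu⟩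
  choose next hnext using hstep
  obtain ⟨u, hu0, husucc⟩ : ∃ u : ℕ → Ω → L2 O, u 0 = w ∧ ∀ k, u (k + 1) = next k (u k) :=
    ⟨fun k => Nat.rec w (fun k v => next k v) k, rfl, fun _ => rfl⟩
  have hgood : ∀ k, Good k (u k) := by
    intro k
    induction k with
    | zero =>
      have h0 : ((0 : ℕ) : ℝ≥0) * τ = 0 := by simp
      rw [hu0]
      refine ⟨?_, hw2, hwp⟩
      rw [h0]
      exact hw
    | succ k ih => rw [husucc]; exact (hnext k (u k) ih).1
  have hprop (k) := (hnext k (u k) (hgood k)).2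
  simp only [← husucc] at hprop
  have husol : IsSol u := (hSol u).2 ⟨by rw [hu0], fun k _ => (hprop k).1⟩
  have huniq : ∀ u v, IsSol u → IsSol v → ∀ k ≤ M, u k =ᵐ[P] v k := by
    intro u v hu hv k
    rw [hSol] at hu hv
    induction k with
    | zero => exact fun _ => hu.1.trans hv.1.symm
    | succ k ih =>
      intro hk
      filter_upwards [ih (by omega), hu.2 k (by omega), hv.2 k (by omega)] with ω h1 h2 h3
      rw [← h1] at h3
      exact h2.unique hτ h3
  refine ⟨⟨⟨u, husol, fun k _ => (hgood k).1⟩, huniq⟩, fun v hv κ hκ0 hκ => ?_⟩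
  -- The estimate is proved for the constructed solution; almost sure uniqueness carries it to any
  -- other, which need not be adapted.
  exact (stable_of_step M hf.K_pos hκ0 fun k => (hprop k).2 κ hκ0 hκ).congr
    (huniq u v husol hv)

theorem trace_eq_tsum (hQ : IsCovariance Q e q) : trace Q e = ∑' j, q j := by
  refine tsum_congr fun j => ?_
  rw [hQ.eigen, real_inner_smul_left, real_inner_self_eq_norm_sq, e.orthonormal.1 j]
  simp

theorem hsNormSq_le_of_modeGrowth (hQ : IsCovariance Q e q) {c₁ : ℝ≥0}
    (h : ModeGrowth ι e q g c₁) (u : L2 O) :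
    hsNormSq ι e q g u ≤ ENNReal.ofReal (c₁ ^ 2 * trace Q e) * ‖u‖ₑ ^ 2 := by
  calc hsNormSq ι e q g u ≤ ∑' j, ENNReal.ofReal (q j) * (c₁ * ‖u‖ₑ) ^ 2 := by
        refine ENNReal.tsum_le_tsum fun j => ?_
        rcases (hQ.nonneg j).eq_or_lt with h0 | h0
        · simp [← h0]
        · gcongr
          exact h j h0 u
    _ = ENNReal.ofReal (c₁ ^ 2 * trace Q e) * ‖u‖ₑ ^ 2 := by
      rw [ENNReal.tsum_mul_right, ← ENNReal.ofReal_tsum_of_nonneg hQ.nonneg hQ.traceClass,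
        trace_eq_tsum hQ, ENNReal.ofReal_mul (by positivity), ENNReal.ofReal_pow c₁.coe_nonneg,
        ENNReal.ofReal_coe_nnreal]
      ring

theorem DiffusionAssumption.hsNormSq_le (hg : DiffusionAssumption ι e q g c) (u : L2 O) :
    hsNormSq ι e q g u ≤ ENNReal.ofReal (c ^ 2) * ‖u‖ₑ ^ 2 := by
  rw [ENNReal.ofReal_pow c.coe_nonneg, ENNReal.ofReal_coe_nnreal, ← mul_pow]
  exact hg.growth u

end Scheme

end TamedSPDE

/-! ### The two schemes as instances -/

theorem theorem4p1 {d : ℕ} (hd : d = 1 ∨ d = 2)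
    (O : Set (E d)) (hO : IsOpen O) (hOb : Bornology.IsBounded O)
    {Ω : Type*} {mΩ : MeasurableSpace Ω} (P : Measure Ω) [IsProbabilityMeasure P]
    (𝓕 : Filtration ℝ≥0 mΩ)
    {U : Type*} [NormedAddCommGroup U] [InnerProductSpace ℝ U]
    (ι : U →L[ℝ] L2 O) (Q : U →L[ℝ] U) (e : HilbertBasis ℕ ℝ U) (q : ℕ → ℝ)
    (hQ : IsCovariance Q e q)
    (β : ℕ → ℝ≥0 → Ω → ℝ) (hβ : IsBrownianFamily P 𝓕 β)
    (f : Polynomial ℝ) (θ α K L : ℝ) (hf : DriftAssumption O f θ α K L)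
    (g : ℝ → ℝ) (c : ℝ≥0) (hg : DiffusionAssumption ι e q g c)
    (u₀ : Ω → L2 O) (hu₀ : StronglyMeasurable[𝓕 0] u₀)
    (hu₀_sq : ∫⁻ ω, ‖u₀ ω‖ₑ ^ 2 ∂P < ∞)
    (hu₀_int : ∀ᵐ ω ∂P, MemLp (u₀ ω) ((2 * f.natDegree : ℕ) : ℝ≥0∞) (mu O))
    (τ : ℝ≥0) (hτ : 0 < τ) (M : ℕ) :
    -- the time scheme
    (UniquelySolvable P 𝓕 τ M (IsTimeSolution P f g τ M (increment ι e q β τ) u₀) ∧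
      ∀ u, IsTimeSolution P f g τ M (increment ι e q β τ) u₀ u →
        (∀ c₁ : ℝ≥0, ModeGrowth ι e q g c₁ →
          Stable P (h10Graph O) τ M K (c₁ ^ 2 * trace Q e) u) ∧
        Stable P (h10Graph O) τ M K (c ^ 2) u) ∧
    -- the fully discrete scheme
    (∀ N : ℕ,
      UniquelySolvable P 𝓕 τ M (IsFullSolution P N f g τ M (increment ι e q β τ) u₀) ∧
      ∀ u, IsFullSolution P N f g τ M (increment ι e q β τ) u₀ u →
        (∀ c₁ : ℝ≥0, ModeGrowth ι e q g c₁ →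
          Stable P (polyGraph O N) τ M K (c₁ ^ 2 * trace Q e) u) ∧
        Stable P (polyGraph O N) τ M K (c ^ 2) u) := by
  have := isFiniteMeasure_mu hOb
  have hκ : ∀ c₁ : ℝ≥0, 0 ≤ (c₁ : ℝ) ^ 2 * trace Q e := fun c₁ => by
    rw [trace_eq_tsum hQ]
    exact mul_nonneg (sq_nonneg _) (tsum_nonneg hQ.nonneg)
  refine ⟨?_, fun N => ?_⟩
  -- An odd degree is at least `1`, so the exponent `2P` lies in the range `q ≥ 2` of the Sobolev
  -- embedding.
  · have hq : 2 ≤ 2 * f.natDegree := by have := hf.odd.pos; omega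
    obtain ⟨h1, h2⟩ := uniquelySolvable_and_stable hβ hQ hf hg isClosed_h10Submodule
      (fun p hp => memLp_of_mem_h10Graph hd hOb _ hq (by rwa [← coe_h10Submodule])) hτ M
      hu₀ hu₀_sq hu₀_int (IsSol := IsTimeSolution P f g τ M (increment ι e q β τ) u₀) fun u => by
        simp_rw [← timeStep_iff hτ]
        exact ⟨fun h => ⟨h.init, h.step⟩, fun h => ⟨h.1, h.2⟩⟩
    rw [coe_h10Submodule] at h2
    exact ⟨h1, fun u hu => ⟨fun c₁ hc₁ => h2 u hu _ (hκ c₁) (hsNormSq_le_of_modeGrowth hQ hc₁),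
      h2 u hu _ (sq_nonneg _) hg.hsNormSq_le⟩⟩
  · obtain ⟨T, hTn, hT⟩ := exists_projection hO hOb N
    have hw2 : ∫⁻ ω, ‖T (u₀ ω)‖ₑ ^ 2 ∂P < ∞ := by
      refine (lintegral_mono fun ω => ?_).trans_lt hu₀_sq
      gcongr
      exact enorm_le_iff_norm_le.2 (hTn _)
    obtain ⟨h1, h2⟩ := uniquelySolvable_and_stable hβ hQ hf hg (isClosed_polySubmodule hO hOb N)
      (fun p hp => memLp_of_mem_polyGraph hO hOb _ (by rwa [← coe_polySubmodule hO hOb])) hτ M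
      (T.continuous.comp_stronglyMeasurable hu₀) hw2
      (Eventually.of_forall fun ω => memLp_of_mem_polyGraph hO hOb _ (hT (u₀ ω)).1.choose_spec)
      (IsSol := IsFullSolution P N f g τ M (increment ι e q β τ) u₀) fun u => by
        -- Uniqueness of the projection turns the initial condition into equality with the adapted
        -- variable `T (u₀ ω)`.
        have hinit : (∀ᵐ ω ∂P, IsProjection N (u₀ ω) (u 0 ω)) ↔ u 0 =ᵐ[P] fun ω => T (u₀ ω) := by
          refine eventually_congr (Eventually.of_forall fun ω => ⟨fun h => ?_, fun h => ?_⟩)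
          · exact h.unique hO hOb (hT _)
          · rw [h]; exact hT _
        simp_rw [← fullStep_iff]
        exact ⟨fun h => ⟨hinit.1 h.init, h.step⟩, fun h => ⟨hinit.2 h.1, h.2⟩⟩
    rw [coe_polySubmodule] at h2
    exact ⟨h1, fun u hu => ⟨fun c₁ hc₁ => h2 u hu _ (hκ c₁) (hsNormSq_le_of_modeGrowth hQ hc₁),
      h2 u hu _ (sq_nonneg _) hg.hsNormSq_le⟩⟩
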